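/- Let $\mathcal{K}$ be an essentially small tensor-triangulated category, i.e. a triangulated category with a symmetric monoidal structure $(\otimes,\mathbb{1})$ that is exact in each variable, and assume that $\mathcal{K}$ is rigid, i.e. every object admits a dual. Let $\mathcal{A}=\mathrm{Mod}\text{-}\mathcal{K}$ be the abelian category of additive functors $\mathcal{K}^{\mathrm{op}}\to\mathrm{Ab}$, with the Yoneda embedding $x\mapsto\hat{x}=\mathrm{Hom}_{\mathcal{K}}(-,x)$ and with the tensor product $\otimes$ given by Day convolution, and let $\mathrm{mod}\text{-}\mathcal{K}\subset\mathcal{A}$ be the full subcategory of finitely presented objects, i.e. of cokernels of morphisms $\hat{y}\to\hat{x}$ with $x,y\in\mathcal{K}$. A *homological prime* is a maximal proper Serre $\otimes$-ideal $\mathcal{B}\subset\mathrm{mod}\text{-}\mathcal{K}$. For such $\mathcal{B}$, let $\langle\mathcal{B}\rangle\subseteq\mathcal{A}$ be the smallest Serre subcategory of $\mathcal{A}$ that contains $\mathcal{B}$ and is closed under coproducts, and let $Q_{\mathcal{B}}:\mathcal{A}\to\mathcal{A}/\langle\mathcal{B}\rangle$ be the Gabriel quotient. Let $x$ be an object of $\mathcal{K}$,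 let $F\in\mathcal{A}$ be $\otimes$-flat, i.e. such that the functor $F\otimes-:\mathcal{A}\to\mathcal{A}$ is exact, and let $f:\hat{x}\to F$ be a morphism in $\mathcal{A}$. Suppose that $Q_{\mathcal{B}}(f)=0$ in $\mathcal{A}/\langle\mathcal{B}\rangle$ for every homological prime $\mathcal{B}\subset\mathrm{mod}\text{-}\mathcal{K}$. Then there exists $m\geq 1$ such that $f^{\otimes m}=0$ in $\mathcal{A}$. -/

import Mathlib

open CategoryTheory Limits MonoidalCategory Opposite

universe v u

noncomputable section

/-! ## The tensor product of abelian groups as a monoidal structure -/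

namespace AddCommGrpCat
open scoped TensorProduct

/-- The map `f ⊗ g : A ⊗[ℤ] B ⟶ A' ⊗[ℤ] B'`. -/
abbrev tensorMap {A A' B B' : AddCommGrpCat.{v}} (f : A ⟶ A') (g : B ⟶ B') :
    AddCommGrpCat.of (A ⊗[ℤ] B) ⟶ AddCommGrpCat.of (A' ⊗[ℤ] B') :=
  ofHom (TensorProduct.map f.hom.toIntLinearMap g.hom.toIntLinearMap).toAddMonoidHom

theorem tensor_hom_ext {A B C : AddCommGrpCat.{v}} {f g : AddCommGrpCat.of (A ⊗[ℤ] B) ⟶ C}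
    (h : ∀ (a : A) (b : B), f.hom (a ⊗ₜ[ℤ] b) = g.hom (a ⊗ₜ[ℤ] b)) : f = g := by
  ext t
  change A ⊗[ℤ] B at t
  induction t with
  | zero => simp
  | tmul a b => exact h a b
  | add x y hx hy => simp [hx, hy]

/-- The monoidal structure on abelian groups given by `A ⊗[ℤ] B`, with unit `ℤ`. -/
instance : MonoidalCategoryStruct AddCommGrpCat.{v} where
  tensorObj A B := of (A ⊗[ℤ] B)
  whiskerLeft A _ _ f := tensorMap (𝟙 A) f
  whiskerRight f B := tensorMap f (𝟙 B)
  tensorHom f g := tensorMap f g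
  tensorUnit := of (ULift.{v} ℤ)
  associator A B C := (TensorProduct.assoc ℤ A B C).toAddEquiv.toAddCommGrpIso
  leftUnitor A := ((TensorProduct.congr ULift.moduleEquiv (LinearEquiv.refl ℤ A)).trans
    (TensorProduct.lid ℤ A)).toAddEquiv.toAddCommGrpIso
  rightUnitor A := ((TensorProduct.congr (LinearEquiv.refl ℤ A) ULift.moduleEquiv).trans
    (TensorProduct.rid ℤ A)).toAddEquiv.toAddCommGrpIso

theorem tensor_hom_ext₃ {A B C D : AddCommGrpCat.{v}} {f g : (A ⊗ B) ⊗ C ⟶ D}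
    (h : ∀ (a : A) (b : B) (c : C),
      f.hom ((a ⊗ₜ[ℤ] b : A ⊗[ℤ] B) ⊗ₜ[ℤ] c) = g.hom ((a ⊗ₜ[ℤ] b : A ⊗[ℤ] B) ⊗ₜ[ℤ] c)) : f = g := by
  refine tensor_hom_ext fun t c => ?_
  change A ⊗[ℤ] B at t
  induction t with
  | zero => simp
  | tmul a b => exact h a b c
  | add x y hx hy => rw [TensorProduct.add_tmul, map_add, map_add, hx, hy]

theorem tensor_hom_ext₄ {A B C D E : AddCommGrpCat.{v}} {f g : ((A ⊗ B) ⊗ C) ⊗ D ⟶ E}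
    (h : ∀ (a : A) (b : B) (c : C) (d : D),
      f.hom (((a ⊗ₜ[ℤ] b : A ⊗[ℤ] B) ⊗ₜ[ℤ] c : (A ⊗[ℤ] B) ⊗[ℤ] C) ⊗ₜ[ℤ] d) =
      g.hom (((a ⊗ₜ[ℤ] b : A ⊗[ℤ] B) ⊗ₜ[ℤ] c : (A ⊗[ℤ] B) ⊗[ℤ] C) ⊗ₜ[ℤ] d)) : f = g := by
  refine tensor_hom_ext₃ fun t c d => ?_
  change A ⊗[ℤ] B at t
  induction t with
  | zero => simp
  | tmul a b => exact h a b c d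
  | add x y hx hy => rw [TensorProduct.add_tmul, TensorProduct.add_tmul, map_add, map_add, hx, hy]

instance : MonoidalCategory AddCommGrpCat.{v} := MonoidalCategory.ofTensorHom
  (id_tensorHom_id := fun A B => tensor_hom_ext fun _ _ => rfl)
  (id_tensorHom := fun A _ _ f => rfl)
  (tensorHom_id := fun f B => rfl)
  (tensorHom_comp_tensorHom := fun f g h k => tensor_hom_ext fun _ _ => rfl)
  (associator_naturality := fun f g h => tensor_hom_ext₃ fun _ _ _ => rfl)
  (leftUnitor_naturality := fun f => tensor_hom_ext fun n a => (map_zsmul f.hom n.down a).symm)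
  (rightUnitor_naturality := fun f => tensor_hom_ext fun a n => (map_zsmul f.hom n.down a).symm)
  (pentagon := fun A B C D => tensor_hom_ext₄ fun _ _ _ _ => rfl)
  (triangle := fun A B => tensor_hom_ext₃ fun a n b => by
    exact (TensorProduct.tmul_smul n.down a b).trans (TensorProduct.smul_tmul' n.down a b))

instance : MonoidalPreadditive AddCommGrpCat.{v} where
  whiskerLeft_zero := tensor_hom_ext fun a _ => TensorProduct.tmul_zero _ a
  zero_whiskerRight := tensor_hom_ext fun _ b => TensorProduct.zero_tmul _ b
  whiskerLeft_add f g := tensor_hom_ext fun a b => TensorProduct.tmul_add a (f.hom b) (g.hom b)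
  add_whiskerRight f g := tensor_hom_ext fun a b => TensorProduct.add_tmul (f.hom a) (g.hom a) b

/-- Tensor-hom adjunction for abelian groups. -/
def tensorLeftAdj (A : AddCommGrpCat.{v}) :
    tensorLeft A ⊣ AddCommGrpCat.coyoneda.obj (op A) :=
  Adjunction.mkOfHomEquiv
    { homEquiv := fun B C =>
        { toFun := fun f => ofHom
            { toFun := fun b =>
                { toFun := fun a => f.hom (a ⊗ₜ[ℤ] b)
                  map_zero' := by rw [TensorProduct.zero_tmul, map_zero]
                  map_add' := fun a a' => by rw [TensorProduct.add_tmul, map_add] }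
              map_zero' := by
                ext a
                exact (congrArg f.hom (TensorProduct.tmul_zero _ a)).trans (map_zero f.hom)
              map_add' := fun b b' => by
                ext a
                exact (congrArg f.hom (TensorProduct.tmul_add a b b')).trans (map_add f.hom _ _) }
          invFun := fun g =>
            let g' : B →+ (A →+ C) := g.hom
            ofHom (TensorProduct.liftAddHom g'.flip (fun n a b => by
              rw [map_zsmul, map_zsmul]; rfl))
          left_inv := fun f => tensor_hom_ext fun _ _ => rfl
          right_inv := fun g => rfl }
      homEquiv_naturality_left_symm := fun _ _ => tensor_hom_ext fun _ _ => rfl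
      homEquiv_naturality_right := fun _ _ => rfl }

instance (A : AddCommGrpCat.{v}) : (tensorLeft A).IsLeftAdjoint := (tensorLeftAdj A).isLeftAdjoint

/-- The symmetry `A ⊗ B ≅ B ⊗ A`, naturally in `B`. -/
def tensorLeftIsoTensorRight (A : AddCommGrpCat.{v}) : tensorLeft A ≅ tensorRight A :=
  NatIso.ofComponents
    (fun B => (TensorProduct.comm ℤ A B).toAddEquiv.toAddCommGrpIso)
    (fun _ => tensor_hom_ext fun _ _ => rfl)

instance (A : AddCommGrpCat.{v}) : (tensorRight A).IsLeftAdjoint :=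
  Functor.isLeftAdjoint_of_iso (tensorLeftIsoTensorRight A)

end AddCommGrpCat

/-! ## Existence of Day convolutions

These are the instances under which Mathlib's Day convolution turns `DayFunctor C Ab` into a
monoidal category, for an essentially small monoidal category `C`. -/

section Day

variable (C : Type u) [Category.{v} C] [MonoidalCategory C] [EssentiallySmall.{v} C]

instance essentiallySmall_prod : EssentiallySmall.{v} (C × C) :=
  EssentiallySmall.mk' ((equivSmallModel.{v} C).prod (equivSmallModel.{v} C))


theorem hasColimitsOfShape_ab (J : Type*) [Category* J] [EssentiallySmall.{v} J] :
    HasColimitsOfShape J AddCommGrpCat.{v} :=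
  hasColimitsOfShape_of_essentiallySmall.{v} J _

instance (d : C) : HasColimitsOfShape (CostructuredArrow (tensor C) d) AddCommGrpCat.{v} :=
  hasColimitsOfShape_ab _

instance (d : C) : HasColimitsOfShape
    (CostructuredArrow (Functor.fromPUnit.{0} (𝟙_ C)) d) AddCommGrpCat.{v} :=
  have : EssentiallySmall.{v} (Discrete PUnit.{1}) := inferInstance
  hasColimitsOfShape_ab _
open scoped ExternalProduct in
instance (F G : C ⥤ AddCommGrpCat.{v}) :
    (tensor C).HasPointwiseLeftKanExtension (F ⊠ G) := fun _ => inferInstance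

instance :
    (Functor.fromPUnit.{0} <| 𝟙_ C).HasPointwiseLeftKanExtension
        (Functor.fromPUnit.{0} <| 𝟙_ AddCommGrpCat.{v}) := fun _ => inferInstance
end Day

namespace TTNilpotence

variable (K : Type u) [Category.{v} K]

/-! ## Tensor-triangulated categories -/

/-- A triangulated category `K` with a symmetric monoidal structure is *tensor-triangulated* if
the tensor product is additive and exact in each variable; by symmetry it suffices to ask that
each functor `x ⊗ -` commutes with the shift and preserves distinguished triangles. -/
class TensorTriangulated [HasZeroObject K] [HasShift K ℤ] [Preadditive K]
    [∀ n : ℤ, (shiftFunctor K n).Additive] [Pretriangulated K]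
    [MonoidalCategory K] [SymmetricCategory K] : Prop extends MonoidalPreadditive K where
  exact_tensorLeft : ∀ x : K, ∃ _ : (tensorLeft x).CommShift ℤ, (tensorLeft x).IsTriangulated

/-! ## The abelian category of modules -/

/-- `Mod-K`, the category of right `K`-modules: additive functors `Kᵒᵖ ⥤ Ab`. -/
abbrev ModCat [Preadditive K] : Type (max u (v + 1)) := Kᵒᵖ ⥤+ AddCommGrpCat.{v}

section abelian

variable {K} [Preadditive K]

theorem additive_of_mono {F G : Kᵒᵖ ⥤ AddCommGrpCat.{v}} (i : F ⟶ G) [Mono i] [G.Additive] :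
    F.Additive where
  map_add {X Y f g} := by
    rw [← cancel_mono (i.app Y)]
    simp [Preadditive.add_comp, Functor.map_add, Preadditive.comp_add]

theorem additive_of_epi {F G : Kᵒᵖ ⥤ AddCommGrpCat.{v}} (p : F ⟶ G) [Epi p] [F.Additive] :
    G.Additive where
  map_add {X Y f g} := by
    rw [← cancel_epi (p.app X)]
    simp [Preadditive.comp_add, Functor.map_add, Preadditive.add_comp, ← NatTrans.naturality]

instance : (additiveFunctor Kᵒᵖ AddCommGrpCat.{v}).ContainsZero where
  exists_zero := by
    obtain ⟨Z, hZ⟩ := HasZeroObject.zero (C := Kᵒᵖ ⥤ AddCommGrpCat.{v})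
    exact ⟨Z, hZ, Functor.Additive.of_isZero hZ⟩

instance : (additiveFunctor Kᵒᵖ AddCommGrpCat.{v}).IsClosedUnderKernels where
  kernels_le := by
    rintro _ ⟨f, k, hk, h, _⟩
    have : Functor.Additive _ := h
    have : Mono k.ι := Fork.IsLimit.mono hk
    exact additive_of_mono k.ι

instance : (additiveFunctor Kᵒᵖ AddCommGrpCat.{v}).IsClosedUnderCokernels where
  cokernels_le := by
    rintro _ ⟨f, k, hk, _, h⟩
    have : Functor.Additive _ := h
    have : Epi k.π := Cofork.IsColimit.epi hk
    exact additive_of_epi k.π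

instance : (additiveFunctor Kᵒᵖ AddCommGrpCat.{v}).IsClosedUnderFiniteProducts where
  isClosedUnderLimitsOfShape J _ :=
    { limitsOfShape_le := by
        rintro F ⟨p⟩
        refine ⟨fun {X Y f g} => ?_⟩
        have hp := isLimitOfPreserves ((evaluation _ _).obj Y) p.isLimit
        refine hp.hom_ext fun j => ?_
        have : (p.diag.obj j).Additive := p.prop_diag_obj j
        simp [Preadditive.add_comp, Functor.map_add, Preadditive.comp_add] }

/-- `Mod-K` is an abelian category, with kernels and cokernels computed objectwise. -/
instance : Abelian (ModCat K) := inferInstance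

end abelian

/-- The Yoneda embedding `h : K ⥤ Mod-K`, `x ↦ x̂ = Hom(-, x)`. -/
def yonedaMod [Preadditive K] : K ⥤ ModCat K :=
  ObjectProperty.lift _ preadditiveYoneda fun x => additive_yonedaObj' x

/-! ## The Day convolution tensor product on modules -/

section tensor

variable [Preadditive K] [MonoidalCategory K] [MonoidalPreadditive K] [HasBinaryBiproducts K]
  [EssentiallySmall.{v} K]

instance : MonoidalPreadditive Kᵒᵖ where
  whiskerLeft_zero := Quiver.Hom.unop_inj (by simp)
  zero_whiskerRight := Quiver.Hom.unop_inj (by simp)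
  whiskerLeft_add f g := Quiver.Hom.unop_inj (by simp)
  add_whiskerRight f g := Quiver.Hom.unop_inj (by simp)

/-- The inclusion of `Mod-K` in the category of all functors `Kᵒᵖ ⥤ Ab`, which is monoidal for Day
convolution. -/
def toDay : ModCat K ⥤ DayFunctor Kᵒᵖ AddCommGrpCat.{v} :=
  AdditiveFunctor.forget _ _ ⋙ (DayFunctor.equiv _ _).inverse

variable {K}

theorem day_map_add (F G : DayFunctor Kᵒᵖ AddCommGrpCat.{v}) [G.functor.Additive] {x y d : Kᵒᵖ}
    (a b : x ⊗ y ⟶ d) :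
    (DayFunctor.η F G).app (x, y) ≫ (F ⊗ G).functor.map (a + b) =
      (DayFunctor.η F G).app (x, y) ≫ (F ⊗ G).functor.map a +
        (DayFunctor.η F G).app (x, y) ≫ (F ⊗ G).functor.map b := by
  let e : x ⊗ (y ⊞ y) ⟶ d := (x ◁ biprod.fst) ≫ a + (x ◁ biprod.snd) ≫ b
  have h1 : x ◁ (biprod.inl : y ⟶ y ⊞ y) ≫ e = a := by
    simp [e, ← whiskerLeft_comp_assoc]
  have h2 : x ◁ (biprod.inr : y ⟶ y ⊞ y) ≫ e = b := by
    simp [e, ← whiskerLeft_comp_assoc]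
  have nat : ∀ (k : y ⟶ y ⊞ y), (DayFunctor.η F G).app (x, y) ≫ (F ⊗ G).functor.map (x ◁ k) =
      (F.functor.obj x ◁ G.functor.map k) ≫ (DayFunctor.η F G).app (x, y ⊞ y) := by
    intro k
    have := (DayFunctor.η F G).naturality (X := (x, y)) (Y := (x, y ⊞ y)) (Prod.mkHom (𝟙 x) k)
    simpa using this.symm
  have h3 : a + b = x ◁ (biprod.inl + biprod.inr : y ⟶ y ⊞ y) ≫ e := by
    rw [MonoidalPreadditive.whiskerLeft_add, Preadditive.add_comp, h1, h2]
  rw [h3, Functor.map_comp, ← Category.assoc, nat, Functor.map_add,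
    MonoidalPreadditive.whiskerLeft_add, Preadditive.add_comp, Preadditive.add_comp, ← nat, ← nat,
    Category.assoc, Category.assoc, ← Functor.map_comp, ← Functor.map_comp, h1, h2]

/-- The Day convolution of additive functors is additive. -/
theorem day_additive (F G : DayFunctor Kᵒᵖ AddCommGrpCat.{v}) [G.functor.Additive] :
    (F ⊗ G).functor.Additive where
  map_add {X Y f g} := by
    have hl := LawfulDayConvolutionMonoidalCategoryStruct.isPointwiseLeftKanExtensionConvolutionExtensionUnit
      (C := Kᵒᵖ) (V := AddCommGrpCat.{v}) F G
    refine (hl X).hom_ext fun j => ?_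
    have h := day_map_add F G (j.hom ≫ f) (j.hom ≫ g)
    have h' : ∀ k : X ⟶ Y,
        (DayFunctor.η F G).app (j.left.1, j.left.2) ≫ (F ⊗ G).functor.map (j.hom ≫ k) =
          ((DayFunctor.η F G).app j.left ≫ (F ⊗ G).functor.map j.hom) ≫
            (F ⊗ G).functor.map k := by
      intro k
      rw [Functor.map_comp, Category.assoc]
    rw [← Preadditive.comp_add, h', h', h', ← Preadditive.comp_add] at h
    exact h

/-- The tensor product `M ⊗ N` of `K`-modules: the Day convolution of the functors `M` and `N`. -/
def tensorObj (M N : ModCat K) : ModCat K where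
  obj := ((toDay K).obj M ⊗ (toDay K).obj N).functor
  property := by
    have : ((toDay K).obj N).functor.Additive := N.property
    exact day_additive _ _

/-- The tensor product `f ⊗ g` of morphisms of `K`-modules. -/
def tensorHom {M M' N N' : ModCat K} (f : M ⟶ M') (g : N ⟶ N') :
    tensorObj M N ⟶ tensorObj M' N' :=
  ObjectProperty.homMk ((toDay K).map f ⊗ₘ (toDay K).map g).natTrans

theorem tensorHom_id (M N : ModCat K) : tensorHom (𝟙 M) (𝟙 N) = 𝟙 (tensorObj M N) := by
  ext : 1
  simp [tensorHom, tensorObj]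

theorem tensorHom_comp {M M' M'' N N' N'' : ModCat K} (f : M ⟶ M') (f' : M' ⟶ M'')
    (g : N ⟶ N') (g' : N' ⟶ N'') :
    tensorHom (f ≫ f') (g ≫ g') = tensorHom f g ≫ tensorHom f' g' := by
  ext : 1
  simp [tensorHom, tensorObj, ← MonoidalCategory.tensorHom_comp_tensorHom]

/-- The functor `F ⊗ - : Mod-K ⥤ Mod-K`. -/
def tensorLeftFunctor (F : ModCat K) : ModCat K ⥤ ModCat K where
  obj M := tensorObj F M
  map g := tensorHom (𝟙 F) g
  map_id M := tensorHom_id F M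
  map_comp g g' := by rw [← tensorHom_comp, Category.comp_id]

/-- A `K`-module `F` is `⊗`-flat if `F ⊗ - : Mod-K ⥤ Mod-K` is exact. -/
def IsTensorFlat (F : ModCat K) : Prop := exactFunctor _ _ (tensorLeftFunctor F)

/-- The tensor powers `M^{⊗ m}`, with `M^{⊗ 0} = 1̂`, `M^{⊗ 1} = M` and
`M^{⊗ (m + 1)} = M^{⊗ m} ⊗ M` for `m ≥ 1`. -/
def tensorPow (M : ModCat K) : ℕ → ModCat K
  | 0 => (yonedaMod K).obj (𝟙_ K)
  | 1 => M
  | m + 2 => tensorObj (tensorPow M (m + 1)) M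

/-- The tensor powers `f^{⊗ m} : M^{⊗ m} ⟶ N^{⊗ m}` of a morphism of `K`-modules. -/
def tensorPowMap {M N : ModCat K} (f : M ⟶ N) : ∀ m : ℕ, tensorPow M m ⟶ tensorPow N m
  | 0 => 𝟙 _
  | 1 => f
  | m + 2 => tensorHom (tensorPowMap f (m + 1)) f

/-- A morphism `f` of `K`-modules is `⊗`-nilpotent if `f^{⊗ m} = 0` for some `m ≥ 1`. -/
def IsTensorNilpotent {M N : ModCat K} (f : M ⟶ N) : Prop :=
  ∃ m : ℕ, 1 ≤ m ∧ tensorPowMap f m = 0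

end tensor

/-! ## Homological primes -/

/-- `mod-K`, the Freyd envelope of `K`, as a full subcategory of `Mod-K`: the finitely presented
`K`-modules, i.e. those `M` with an exact sequence `ŷ ⟶ x̂ ⟶ M ⟶ 0` with `x`, `y` in `K`. -/
def finitelyPresented [Preadditive K] : ObjectProperty (ModCat K) := fun M =>
  ∃ (x y : K) (a : (yonedaMod K).obj y ⟶ (yonedaMod K).obj x) (p : (yonedaMod K).obj x ⟶ M)
    (w : a ≫ p = 0), Epi p ∧ (ShortComplex.mk a p w).Exact

section primes

variable {K} [Preadditive K] [MonoidalCategory K] [MonoidalPreadditive K] [HasBinaryBiproducts K]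
  [EssentiallySmall.{v} K]

/-- `B` is a Serre `⊗`-ideal of `mod-K`. Subcategories of `mod-K` are encoded as classes of objects
of `Mod-K` contained in `mod-K`. -/
structure IsSerreTensorIdeal (B : ObjectProperty (ModCat K)) : Prop where
  le_finitelyPresented : B ≤ finitelyPresented K
  zero : B.ContainsZero
  /-- Among finitely presented modules `B` is closed under subobjects, quotients, extensions. -/
  shortExact : ∀ S : ShortComplex (ModCat K), S.ShortExact → finitelyPresented K S.X₁ →
    finitelyPresented K S.X₂ → finitelyPresented K S.X₃ → (B S.X₂ ↔ B S.X₁ ∧ B S.X₃)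
  tensor : ∀ M N : ModCat K, finitelyPresented K M → B N → B (tensorObj M N)

/-- A homological prime: a maximal proper Serre `⊗`-ideal `B ⊂ mod-K`. -/
def IsHomologicalPrime (B : ObjectProperty (ModCat K)) : Prop :=
  Maximal (fun C => IsSerreTensorIdeal C ∧ C ≠ finitelyPresented K) B

end primes

/-! ## Gabriel quotients -/

section quotient

variable {K} [Preadditive K]

/-- `⟨B⟩`, the localizing subcategory of `Mod-K` generated by `B`: the smallest Serre subcategory
which contains `B` and is closed under (small) coproducts. -/
def localizingClosure (B : ObjectProperty (ModCat K)) : ObjectProperty (ModCat K) := fun M =>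
  ∀ P : ObjectProperty (ModCat K), P.IsSerreClass →
    (∀ J : Type v, P.IsClosedUnderColimitsOfShape (Discrete J)) → B ≤ P → P M

instance (B : ObjectProperty (ModCat K)) : (localizingClosure B).IsSerreClass where
  exists_zero := by
    obtain ⟨Z, hZ⟩ := HasZeroObject.zero (C := ModCat K)
    refine ⟨Z, hZ, fun P _ _ _ => ?_⟩
    obtain ⟨Z', hZ', h⟩ := P.exists_prop_of_containsZero
    exact P.prop_of_iso (hZ'.iso hZ) h
  prop_of_mono f _ h P hP hJ hB := P.prop_of_mono f (h P hP hJ hB)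
  prop_of_epi f _ h P hP hJ hB := P.prop_of_epi f (h P hP hJ hB)
  prop_X₂_of_shortExact hS h₁ h₃ P hP hJ hB :=
    P.prop_X₂_of_shortExact hS (h₁ P hP hJ hB) (h₃ P hP hJ hB)

/-- The Gabriel quotient `(Mod-K)/⟨B⟩`: the localization of `Mod-K` at the morphisms whose kernel
and cokernel belong to `⟨B⟩`. -/
abbrev GabrielQuotient (B : ObjectProperty (ModCat K)) : Type (max u (v + 1)) :=
  (localizingClosure B).isoModSerre.Localization

/-- The quotient functor `Q_B : Mod-K ⥤ (Mod-K)/⟨B⟩`. -/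
abbrev gabrielQuotient (B : ObjectProperty (ModCat K)) : ModCat K ⥤ GabrielQuotient B :=
  (localizingClosure B).isoModSerre.Q

end quotient

end TTNilpotence

end

open TTNilpotence

/-!
# Nilpotence of morphisms into flat modules

Let `f : x̂ ⟶ F` be a morphism into a `⊗`-flat module. The finitely presented modules `M` with
`f ⊗ ⋯ ⊗ f ⊗ M = 0` for some number of factors form a Serre `⊗`-ideal `I` of `mod-K`
(`killedIdeal_isSerreTensorIdeal`). Closure under quotients holds because the tensor product is
right exact; closure under subobjects and extensions is where flatness of `F` enters
(`TensorKilled.of_exact`). The morphism `f` is `⊗`-nilpotent as soon as `1̂` belongs to `I`.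

Suppose that `1̂` does not belong to `I`. By Zorn's lemma `I` is contained in a homological prime
`B`. Since `f` vanishes in the Gabriel quotient by `⟨B⟩`, it kills the image of some `a : y ⟶ x`
whose cokernel lies in `B` (`exists_coker_of_gabrielQuotient_map_eq_zero`): the modules all of whose
sections over each `z` are killed by some such morphism `w ⟶ z` form a Serre class which is closed
under coproducts and contains `B`. Rigidity moves this from `x` to the unit: there is a morphism
`k : w ⟶ 1` with cokernel in `B` such that `x ⊗ k` factors through `a`
(`IsSerreTensorIdeal.exists_unit_coker`). Let `J ⊆ 1̂` be the image of `k`. Then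
`x̂ ⊗ J ⟶ F ⊗ J ⊆ F` vanishes, as it is induced by `f ∘ a = 0`, so that `f ⊗ J = 0` and `J` lies in
`I ⊆ B` (`tensorHom_kernel_eq_zero`). Now `1̂` is an extension of the cokernel of `k` by `J`, both in
`B`, which contradicts the properness of `B`.

The triangulated structure of `K` is used only through weak kernels, which make `mod-K` an abelian
subcategory of `Mod-K` (`exists_weakKernel`, `finitelyPresented_of_shortExact`). Modules are handled
through their groups of sections `Sec M y = M(y)`, and the Day convolution through its universal
property: `M ⊗ N` is generated by pure tensors `tmul m n`, a section over `y ⊗ z`.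
-/

noncomputable section

namespace TTNilpotence

/-! ### Sections of modules -/

section sections

variable {K : Type u} [Category.{v} K] [Preadditive K]

/-- The abelian group `M(y)` of sections of a `K`-module `M` over an object `y` of `K`. -/
abbrev Sec (M : ModCat K) (y : K) : Type v := M.obj.obj (op y)

/-- The action of a morphism of `K`-modules on sections. -/
def secMap {M N : ModCat K} (g : M ⟶ N) (y : K) : Sec M y →+ Sec N y := (g.hom.app (op y)).hom

/-- The restriction of sections of a `K`-module along a morphism of `K`. -/
def res (M : ModCat K) {z y : K} (k : z ⟶ y) : Sec M y →+ Sec M z := (M.obj.map k.op).hom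

@[simp]
theorem res_id (M : ModCat K) (y : K) (m : Sec M y) : res M (𝟙 y) m = m := by
  simp [res]

theorem res_comp (M : ModCat K) {w z y : K} (k : w ⟶ z) (l : z ⟶ y) (m : Sec M y) :
    res M (k ≫ l) m = res M k (res M l m) := by
  simp [res]

theorem res_add_hom (M : ModCat K) {z y : K} (k l : z ⟶ y) (m : Sec M y) :
    res M (k + l) m = res M k m + res M l m := by
  have : M.obj.Additive := M.property
  have : M.obj.map (k.op + l.op) = M.obj.map k.op + M.obj.map l.op := Functor.map_add _
  simp [res, this]

@[simp]
theorem res_zero_hom (M : ModCat K) {z y : K} (m : Sec M y) :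
    res M (0 : z ⟶ y) m = 0 := by
  simpa using res_add_hom M (0 : z ⟶ y) 0 m

theorem secMap_res {M N : ModCat K} (g : M ⟶ N) {z y : K} (k : z ⟶ y) (m : Sec M y) :
    secMap g z (res M k m) = res N k (secMap g y m) :=
  ConcreteCategory.congr_hom (g.hom.naturality k.op) m

@[simp]
theorem secMap_id (M : ModCat K) (y : K) (m : Sec M y) : secMap (𝟙 M) y m = m := rfl

@[simp]
theorem secMap_comp {M N P : ModCat K} (g : M ⟶ N) (h : N ⟶ P) (y : K) (m : Sec M y) :
    secMap (g ≫ h) y m = secMap h y (secMap g y m) := rfl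

@[simp]
theorem secMap_zero (M N : ModCat K) (y : K) (m : Sec M y) : secMap (0 : M ⟶ N) y m = 0 := rfl

theorem mod_hom_ext {M N : ModCat K} {g h : M ⟶ N}
    (H : ∀ (y : K) (m : Sec M y), secMap g y m = secMap h y m) : g = h := by
  ext y m
  exact H y.unop m

/-- A natural family of group homomorphisms is a morphism of `K`-modules. -/
def homOfSec {M N : ModCat K} (φ : ∀ y, Sec M y →+ Sec N y)
    (hφ : ∀ {z y : K} (k : z ⟶ y) (m : Sec M y), φ z (res M k m) = res N k (φ y m)) : M ⟶ N :=
  ObjectProperty.homMk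
    { app := fun y => AddCommGrpCat.ofHom (φ y.unop)
      naturality := fun y z k => by
        ext m
        exact hφ k.unop m }

@[simp]
theorem secMap_homOfSec {M N : ModCat K} (φ : ∀ y, Sec M y →+ Sec N y)
    (hφ : ∀ {z y : K} (k : z ⟶ y) (m : Sec M y), φ z (res M k m) = res N k (φ y m))
    (y : K) (m : Sec M y) : secMap (homOfSec φ hφ) y m = φ y m := rfl

/-! ### The Yoneda lemma -/

/-- A morphism `g : z ⟶ y` of `K`, as a section of `ŷ` over `z`. -/
def ySec {y z : K} (g : z ⟶ y) : Sec ((yonedaMod K).obj y) z := g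

theorem ySec_surjective {y z : K} (s : Sec ((yonedaMod K).obj y) z) : ∃ g : z ⟶ y, ySec g = s :=
  ⟨s, rfl⟩

theorem ySec_injective {y z : K} {g h : z ⟶ y} (e : ySec g = ySec h) : g = h := e

theorem ySec_add {y z : K} (g h : z ⟶ y) : ySec (g + h) = ySec g + ySec h := rfl

@[simp]
theorem res_ySec {y z w : K} (k : w ⟶ z) (g : z ⟶ y) :
    res ((yonedaMod K).obj y) k (ySec g) = ySec (k ≫ g) := rfl

@[simp]
theorem secMap_yoneda {y y' z : K} (a : y ⟶ y') (g : z ⟶ y) :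
    secMap ((yonedaMod K).map a) z (ySec g) = ySec (g ≫ a) := rfl

/-- The morphism `ŷ ⟶ M` corresponding to a section of `M` over `y`. -/
def ofSec {M : ModCat K} {y : K} (m : Sec M y) : (yonedaMod K).obj y ⟶ M :=
  homOfSec (M := (yonedaMod K).obj y)
    (fun z =>
      { toFun := fun (g : z ⟶ y) => res M g m
        map_zero' := res_zero_hom M m
        map_add' := fun g h => res_add_hom M g h m })
    (fun k (g : _ ⟶ y) => res_comp M k g m)

@[simp]
theorem secMap_ofSec {M : ModCat K} {y z : K} (m : Sec M y) (g : z ⟶ y) :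
    secMap (ofSec m) z (ySec g) = res M g m := rfl

theorem secMap_ySec {M : ModCat K} {y z : K} (h : (yonedaMod K).obj y ⟶ M) (g : z ⟶ y) :
    secMap h z (ySec g) = res M g (secMap h y (ySec (𝟙 y))) := by
  rw [← secMap_res, res_ySec, Category.comp_id]

theorem yoneda_hom_ext {M : ModCat K} {y : K} {g h : (yonedaMod K).obj y ⟶ M}
    (e : secMap g y (ySec (𝟙 y)) = secMap h y (ySec (𝟙 y))) : g = h := by
  refine mod_hom_ext fun z s => ?_
  obtain ⟨s, rfl⟩ := ySec_surjective s
  rw [secMap_ySec, secMap_ySec h, e]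

theorem ofSec_comp {M N : ModCat K} {y : K} (m : Sec M y) (g : M ⟶ N) :
    ofSec m ≫ g = ofSec (secMap g y m) :=
  yoneda_hom_ext (by simp)

theorem ofSec_secMap {M : ModCat K} {y : K} (h : (yonedaMod K).obj y ⟶ M) :
    ofSec (secMap h y (ySec (𝟙 y))) = h :=
  yoneda_hom_ext (by simp)

theorem yoneda_comp_eq_zero_iff {M : ModCat K} {y z : K} (a : z ⟶ y)
    (h : (yonedaMod K).obj y ⟶ M) :
    (yonedaMod K).map a ≫ h = 0 ↔ res M a (secMap h y (ySec (𝟙 y))) = 0 := by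
  constructor
  · intro e
    rw [← secMap_ySec]
    simpa using congrArg (fun k => secMap k z (ySec (𝟙 z))) e
  · intro e
    refine yoneda_hom_ext ?_
    simpa [secMap_ySec h a] using e

/-- The Yoneda embedding is full. -/
theorem yoneda_map_surjective {y z : K} (h : (yonedaMod K).obj z ⟶ (yonedaMod K).obj y) :
    ∃ a : z ⟶ y, (yonedaMod K).map a = h := by
  obtain ⟨a, ha⟩ := ySec_surjective (secMap h z (ySec (𝟙 z)))
  refine ⟨a, yoneda_hom_ext ?_⟩
  rw [← ha]
  simp

end sections

/-! ### Exactness in terms of sections -/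

theorem exact_iff_evaluation {C : Type u} [Category.{v} C]
    (S : ShortComplex (C ⥤ AddCommGrpCat.{v})) :
    S.Exact ↔ ∀ y, (S.map ((evaluation _ _).obj y)).Exact := by
  simp only [ShortComplex.exact_iff_isZero_homology, Functor.isZero_iff]
  exact forall_congr' fun y =>
    (S.mapHomologyIso ((evaluation _ _).obj y)).symm.isZero_iff

section exactness

variable {K : Type u} [Category.{v} K] [Preadditive K]

instance : (AdditiveFunctor.forget Kᵒᵖ AddCommGrpCat.{v}).PreservesHomology where
  preservesKernels _ _ f := ObjectProperty.preservesKernels_ι _ f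
  preservesCokernels _ _ f := ObjectProperty.preservesCokernels_ι _ f

/-- A sequence of `K`-modules is exact if and only if it is exact on sections. -/
theorem exact_iff_sec (S : ShortComplex (ModCat K)) :
    S.Exact ↔ ∀ (y : K) (m : Sec S.X₂ y), secMap S.g y m = 0 → ∃ n, secMap S.f y n = m := by
  rw [← S.exact_map_iff_of_faithful (AdditiveFunctor.forget Kᵒᵖ AddCommGrpCat.{v}),
    exact_iff_evaluation]
  simp only [ShortComplex.ab_exact_iff]
  exact ⟨fun h y => h (op y), fun h y => h y.unop⟩

theorem mono_iff_sec {M N : ModCat K} (g : M ⟶ N) :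
    Mono g ↔ ∀ y, Function.Injective (secMap g y) := by
  have h := ShortComplex.exact_iff_mono (ShortComplex.mk (0 : M ⟶ M) g (by simp)) rfl
  rw [← h, exact_iff_sec]
  refine forall_congr' fun y => ?_
  rw [injective_iff_map_eq_zero]
  refine forall_congr' fun m => ?_
  exact ⟨fun h e => by obtain ⟨n, hn⟩ := h e; exact hn.symm, fun h e => ⟨0, (h e).symm⟩⟩

theorem epi_iff_sec {M N : ModCat K} (g : M ⟶ N) :
    Epi g ↔ ∀ y, Function.Surjective (secMap g y) := by
  have h := ShortComplex.exact_iff_epi (ShortComplex.mk g (0 : N ⟶ N) (by simp)) rfl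
  rw [← h, exact_iff_sec]
  exact forall_congr' fun y => ⟨fun h m => h m rfl, fun h m _ => h m⟩

theorem exact_sec {S : ShortComplex (ModCat K)} (hS : S.Exact) {y : K} {m : Sec S.X₂ y}
    (hm : secMap S.g y m = 0) : ∃ n, secMap S.f y n = m :=
  (exact_iff_sec S).1 hS y m hm

/-- Representable modules are projective. -/
theorem yoneda_lift {M N : ModCat K} (p : M ⟶ N) [Epi p] {y : K}
    (h : (yonedaMod K).obj y ⟶ N) : ∃ l : (yonedaMod K).obj y ⟶ M, l ≫ p = h := by
  obtain ⟨m, hm⟩ := (epi_iff_sec p).1 inferInstance y (secMap h y (ySec (𝟙 y)))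
  exact ⟨ofSec m, by rw [ofSec_comp, hm, ofSec_secMap]⟩

/-- A morphism from a representable module into the middle of an exact sequence lifts to the left
end if it dies in the right end. -/
theorem yoneda_lift_exact {S : ShortComplex (ModCat K)} (hS : S.Exact) {y : K}
    (h : (yonedaMod K).obj y ⟶ S.X₂) (w : h ≫ S.g = 0) :
    ∃ l : (yonedaMod K).obj y ⟶ S.X₁, l ≫ S.f = h := by
  obtain ⟨n, hn⟩ := exact_sec hS (m := secMap h y (ySec (𝟙 y)))
    (by rw [← secMap_comp, w, secMap_zero])
  exact ⟨ofSec n, by rw [ofSec_comp, hn, ofSec_secMap]⟩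

end exactness

/-! ### Pure tensors and the universal property of the tensor product -/

section tensor

open scoped TensorProduct

variable {K : Type u} [Category.{v} K] [Preadditive K] [MonoidalCategory K]
  [MonoidalPreadditive K] [HasBinaryBiproducts K] [EssentiallySmall.{v} K]

/-- The structure map `M(y) ⊗ N(z) → (M ⊗ N)(y ⊗ z)` of the Day convolution. -/
def tensorUnitHom (M N : ModCat K) (y z : K) :
    Sec M y ⊗[ℤ] Sec N z →+ Sec (tensorObj M N) (y ⊗ z) :=
  ((DayFunctor.η ((toDay K).obj M) ((toDay K).obj N)).app (op y, op z)).hom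

/-- The pure tensor `m ⊗ n` over `y ⊗ z` of sections `m` of `M` over `y` and `n` of `N` over `z`. -/
def tmul {M N : ModCat K} {y z : K} (m : Sec M y) (n : Sec N z) : Sec (tensorObj M N) (y ⊗ z) :=
  tensorUnitHom M N y z (m ⊗ₜ[ℤ] n)

section
variable {M N : ModCat K} {y z : K}

theorem tmul_add (m : Sec M y) (n n' : Sec N z) : tmul m (n + n') = tmul m n + tmul m n' := by
  rw [tmul, TensorProduct.tmul_add, map_add]
  rfl

theorem add_tmul (m m' : Sec M y) (n : Sec N z) : tmul (m + m') n = tmul m n + tmul m' n := by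
  rw [tmul, TensorProduct.add_tmul, map_add]
  rfl

@[simp]
theorem tmul_zero (m : Sec M y) : tmul m (0 : Sec N z) = 0 := by
  simpa using tmul_add m (0 : Sec N z) 0

@[simp]
theorem zero_tmul (n : Sec N z) : tmul (0 : Sec M y) n = 0 := by
  simpa using add_tmul (0 : Sec M y) 0 n

theorem tmul_res {y' z' : K} (k : y' ⟶ y) (l : z' ⟶ z) (m : Sec M y) (n : Sec N z) :
    tmul (res M k m) (res N l n) = res (tensorObj M N) (k ⊗ₘ l) (tmul m n) :=
  ConcreteCategory.congr_hom
    ((DayFunctor.η ((toDay K).obj M) ((toDay K).obj N)).naturality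
      (X := (op y, op z)) (Y := (op y', op z')) (Prod.mkHom k.op l.op)) (m ⊗ₜ[ℤ] n)

end

/-- Morphisms out of a tensor product are determined by their values on pure tensors. -/
theorem tensorObj_hom_ext {M N P : ModCat K} {g h : tensorObj M N ⟶ P}
    (H : ∀ (y z : K) (m : Sec M y) (n : Sec N z),
      secMap g (y ⊗ z) (tmul m n) = secMap h (y ⊗ z) (tmul m n)) : g = h := by
  have : (⟨g.hom⟩ : (toDay K).obj M ⊗ (toDay K).obj N ⟶ (toDay K).obj P) = ⟨h.hom⟩ :=
    DayFunctor.tensor_hom_ext fun y z =>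
      AddCommGrpCat.tensor_hom_ext fun m n => H y.unop z.unop m n
  ext : 1
  exact congrArg DayFunctor.Hom.natTrans this

@[simp]
theorem secMap_tensorHom {M M' N N' : ModCat K} (f : M ⟶ M') (g : N ⟶ N') {y z : K}
    (m : Sec M y) (n : Sec N z) :
    secMap (tensorHom f g) (y ⊗ z) (tmul m n) = tmul (secMap f y m) (secMap g z n) :=
  ConcreteCategory.congr_hom
    (LawfulDayConvolutionMonoidalCategoryStruct.convolutionExtensionUnit_comp_ι_map_tensorHom_app
      Kᵒᵖ AddCommGrpCat.{v} ((toDay K).map f) ((toDay K).map g) (op y) (op z)) (m ⊗ₜ[ℤ] n)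

/-- The homomorphism `A ⊗ B → C` given by a biadditive map. -/
def liftBiadditive {A B C : Type*} [AddCommGroup A] [AddCommGroup B] [AddCommGroup C]
    (φ : A →+ B →+ C) : A ⊗[ℤ] B →+ C :=
  TensorProduct.liftAddHom φ fun n a b => by simp

/-- The morphism `M ⊗ N ⟶ P` given by a natural biadditive family of maps
`M(y) × N(z) → P(y ⊗ z)`. -/
def tensorDesc {M N P : ModCat K} (φ : ∀ y z, Sec M y →+ Sec N z →+ Sec P (y ⊗ z))
    (hφ : ∀ {y z y' z' : K} (k : y' ⟶ y) (l : z' ⟶ z) (m : Sec M y) (n : Sec N z),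
      φ y' z' (res M k m) (res N l n) = res P (k ⊗ₘ l) (φ y z m n)) : tensorObj M N ⟶ P :=
  ObjectProperty.homMk (DayFunctor.tensorDesc (F := (toDay K).obj M) (G := (toDay K).obj N)
    (H := (toDay K).obj P)
    { app := fun p => AddCommGrpCat.ofHom
        (liftBiadditive (φ p.1.unop p.2.unop))
      naturality := fun _ _ k => AddCommGrpCat.tensor_hom_ext fun m n =>
        hφ k.1.unop k.2.unop m n }).natTrans

@[simp]
theorem secMap_tensorDesc {M N P : ModCat K} (φ : ∀ y z, Sec M y →+ Sec N z →+ Sec P (y ⊗ z))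
    (hφ : ∀ {y z y' z' : K} (k : y' ⟶ y) (l : z' ⟶ z) (m : Sec M y) (n : Sec N z),
      φ y' z' (res M k m) (res N l n) = res P (k ⊗ₘ l) (φ y z m n))
    {y z : K} (m : Sec M y) (n : Sec N z) :
    secMap (tensorDesc φ hφ) (y ⊗ z) (tmul m n) = φ y z m n :=
  ConcreteCategory.congr_hom
    (DayFunctor.η_comp_tensorDesc_app (F := (toDay K).obj M) (G := (toDay K).obj N)
      (H := (toDay K).obj P) _ (op y) (op z)) (m ⊗ₜ[ℤ] n)

/-- Pure tensors as a biadditive map. -/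
def tmulHom (M N : ModCat K) (y z : K) : Sec M y →+ Sec N z →+ Sec (tensorObj M N) (y ⊗ z) :=
  AddMonoidHom.mk' (fun m => AddMonoidHom.mk' (tmul m) (tmul_add m))
    (fun m m' => AddMonoidHom.ext (add_tmul m m'))

@[simp]
theorem tmulHom_apply {M N : ModCat K} {y z : K} (m : Sec M y) (n : Sec N z) :
    tmulHom M N y z m n = tmul m n := rfl

end tensor

/-! ### Associativity and unit of the tensor product -/

section tensor

variable {K : Type u} [Category.{v} K] [Preadditive K] [MonoidalCategory K]
  [MonoidalPreadditive K]

/-- The pairing `(m, g) ↦ m · g` of sections `m` of `M` over `y` and morphisms `g : z ⟶ 1`. -/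
def unitPairing (M : ModCat K) (y z : K) :
    Sec M y →+ Sec ((yonedaMod K).obj (𝟙_ K)) z →+ Sec M (y ⊗ z) :=
  AddMonoidHom.flip (M := z ⟶ 𝟙_ K)
    (AddMonoidHom.mk' (fun g => res M (y ◁ g ≫ (ρ_ y).hom)) fun g h => by
      ext m
      rw [MonoidalPreadditive.whiskerLeft_add, Preadditive.add_comp, res_add_hom]
      rfl)

@[simp]
theorem unitPairing_apply (M : ModCat K) (y z : K) (m : Sec M y) (g : z ⟶ 𝟙_ K) :
    unitPairing M y z m (ySec g) = res M (y ◁ g ≫ (ρ_ y).hom) m := rfl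

theorem unitPairing_res (M : ModCat K) {y z y' z' : K} (k : y' ⟶ y) (l : z' ⟶ z) (m : Sec M y)
    (n : Sec ((yonedaMod K).obj (𝟙_ K)) z) :
    unitPairing M y' z' (res M k m) (res _ l n) = res M (k ⊗ₘ l) (unitPairing M y z m n) := by
  obtain ⟨n, rfl⟩ := ySec_surjective n
  simp only [res_ySec, unitPairing_apply, ← res_comp]
  simp [tensorHom_def', ← whisker_exchange_assoc]

/-- The pairing `(g, h) ↦ g ⊗ h` of morphisms `g : y ⟶ x` and `h : z ⟶ w`. -/
def yonedaPairing (x w y z : K) :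
    Sec ((yonedaMod K).obj x) y →+ Sec ((yonedaMod K).obj w) z →+
      Sec ((yonedaMod K).obj (x ⊗ w)) (y ⊗ z) :=
  AddMonoidHom.mk' (fun (g : y ⟶ x) => AddMonoidHom.mk' (M := z ⟶ w) (fun h => ySec (g ⊗ₘ h))
      fun h h' => by rw [MonoidalPreadditive.tensor_add, ySec_add])
    fun (g g' : y ⟶ x) => AddMonoidHom.ext fun (h : z ⟶ w) =>
      congrArg ySec (MonoidalPreadditive.add_tensor g g' h)

@[simp]
theorem yonedaPairing_apply {x w y z : K} (g : y ⟶ x) (h : z ⟶ w) :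
    yonedaPairing x w y z (ySec g) (ySec h) = ySec (g ⊗ₘ h) := rfl

theorem yonedaPairing_res (x w : K) {y z y' z' : K} (k : y' ⟶ y) (l : z' ⟶ z)
    (g : Sec ((yonedaMod K).obj x) y) (h : Sec ((yonedaMod K).obj w) z) :
    yonedaPairing x w y' z' (res _ k g) (res _ l h) =
      res _ (k ⊗ₘ l) (yonedaPairing x w y z g h) := by
  obtain ⟨g, rfl⟩ := ySec_surjective g
  obtain ⟨h, rfl⟩ := ySec_surjective h
  simp

variable [HasBinaryBiproducts K] [EssentiallySmall.{v} K]

@[simp]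
theorem tensorHom_zero {M M' N N' : ModCat K} (f : M ⟶ M') :
    tensorHom f (0 : N ⟶ N') = 0 :=
  tensorObj_hom_ext fun y z m n => by simp

@[simp]
theorem zero_tensorHom {M M' N N' : ModCat K} (g : N ⟶ N') :
    tensorHom (0 : M ⟶ M') g = 0 :=
  tensorObj_hom_ext fun y z m n => by simp

instance (F : ModCat K) : (tensorLeftFunctor F).PreservesZeroMorphisms where
  map_zero _ _ := tensorHom_zero _

/-- The tensor product of two isomorphisms. -/
@[simps]
def tensorIso {M M' N N' : ModCat K} (e : M ≅ M') (e' : N ≅ N') :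
    tensorObj M N ≅ tensorObj M' N' where
  hom := tensorHom e.hom e'.hom
  inv := tensorHom e.inv e'.inv
  hom_inv_id := by rw [← tensorHom_comp, e.hom_inv_id, e'.hom_inv_id, tensorHom_id]
  inv_hom_id := by rw [← tensorHom_comp, e.inv_hom_id, e'.inv_hom_id, tensorHom_id]

/-- The associativity isomorphism, inherited from the Day convolution of all functors. -/
def assocIso (M N P : ModCat K) :
    tensorObj (tensorObj M N) P ≅ tensorObj M (tensorObj N P) where
  hom := ObjectProperty.homMk
    (α_ ((toDay K).obj M) ((toDay K).obj N) ((toDay K).obj P)).hom.natTrans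
  inv := ObjectProperty.homMk
    (α_ ((toDay K).obj M) ((toDay K).obj N) ((toDay K).obj P)).inv.natTrans
  hom_inv_id := by
    ext : 1
    exact congrArg DayFunctor.Hom.natTrans
      (α_ ((toDay K).obj M) ((toDay K).obj N) ((toDay K).obj P)).hom_inv_id
  inv_hom_id := by
    ext : 1
    exact congrArg DayFunctor.Hom.natTrans
      (α_ ((toDay K).obj M) ((toDay K).obj N) ((toDay K).obj P)).inv_hom_id

theorem assocIso_naturality {M M' N N' P P' : ModCat K} (f : M ⟶ M') (g : N ⟶ N') (h : P ⟶ P') :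
    tensorHom (tensorHom f g) h ≫ (assocIso M' N' P').hom =
      (assocIso M N P).hom ≫ tensorHom f (tensorHom g h) := by
  ext : 1
  exact congrArg DayFunctor.Hom.natTrans
    (associator_naturality ((toDay K).map f) ((toDay K).map g) ((toDay K).map h))

/-- The isomorphism `M ⊗ 1̂ ≅ M`. -/
def rightUnitIso (M : ModCat K) : tensorObj M ((yonedaMod K).obj (𝟙_ K)) ≅ M where
  hom := tensorDesc (unitPairing M) (unitPairing_res M)
  inv := homOfSec
    (fun y => (res (tensorObj M ((yonedaMod K).obj (𝟙_ K))) (ρ_ y).inv).comp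
      ((tmulHom M _ y (𝟙_ K)).flip (ySec (𝟙 _))))
    (fun {z y} k m => by
      have := tmul_res k (𝟙 _) m (ySec (𝟙 (𝟙_ K)))
      simp only [res_id] at this
      simp only [AddMonoidHom.comp_apply, AddMonoidHom.flip_apply, tmulHom_apply, this,
        ← res_comp, MonoidalCategory.tensorHom_id, rightUnitor_inv_naturality])
  hom_inv_id := tensorObj_hom_ext fun y z m n => by
    obtain ⟨n, rfl⟩ := ySec_surjective n
    have := tmul_res (𝟙 y) n m (ySec (𝟙 (𝟙_ K)))
    simp only [res_id, res_ySec, Category.comp_id] at this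
    rw [secMap_comp, secMap_tensorDesc, unitPairing_apply, secMap_res]
    simp [this, ← res_comp]
  inv_hom_id := mod_hom_ext fun y m => by
    rw [secMap_comp, secMap_homOfSec, AddMonoidHom.comp_apply, AddMonoidHom.flip_apply,
      tmulHom_apply, secMap_res, secMap_tensorDesc]
    simp [← res_comp]

@[simp]
theorem secMap_rightUnitIso_hom (M : ModCat K) {y z : K} (m : Sec M y) (g : z ⟶ 𝟙_ K) :
    secMap (rightUnitIso M).hom (y ⊗ z) (tmul m (ySec g)) = res M (y ◁ g ≫ (ρ_ y).hom) m :=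
  secMap_tensorDesc _ (unitPairing_res M) _ _

theorem rightUnitIso_naturality {M N : ModCat K} (f : M ⟶ N) :
    tensorHom f (𝟙 _) ≫ (rightUnitIso N).hom = (rightUnitIso M).hom ≫ f :=
  tensorObj_hom_ext fun y z m n => by
    obtain ⟨n, rfl⟩ := ySec_surjective n
    simp [secMap_res]

/-- The Yoneda embedding is compatible with tensor products: `x̂ ⊗ ŵ ≅ (x ⊗ w)^`. -/
def yonedaTensorIso (x w : K) :
    tensorObj ((yonedaMod K).obj x) ((yonedaMod K).obj w) ≅ (yonedaMod K).obj (x ⊗ w) where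
  hom := tensorDesc (yonedaPairing x w) (yonedaPairing_res x w)
  inv := ofSec (tmul (ySec (𝟙 x)) (ySec (𝟙 w)))
  hom_inv_id := tensorObj_hom_ext fun y z g h => by
    obtain ⟨g, rfl⟩ := ySec_surjective g
    obtain ⟨h, rfl⟩ := ySec_surjective h
    simp [← tmul_res]
  inv_hom_id := yoneda_hom_ext (by simp)

@[simp]
theorem secMap_yonedaTensorIso_hom {x w y z : K} (g : y ⟶ x) (h : z ⟶ w) :
    secMap (yonedaTensorIso x w).hom (y ⊗ z) (tmul (ySec g) (ySec h)) = ySec (g ⊗ₘ h) :=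
  secMap_tensorDesc _ (yonedaPairing_res x w) _ _

theorem yonedaTensorIso_naturality_right (x : K) {w w' : K} (k : w ⟶ w') :
    tensorHom (𝟙 ((yonedaMod K).obj x)) ((yonedaMod K).map k) ≫ (yonedaTensorIso x w').hom =
      (yonedaTensorIso x w).hom ≫ (yonedaMod K).map (x ◁ k) :=
  tensorObj_hom_ext fun y z g h => by
    obtain ⟨g, rfl⟩ := ySec_surjective g
    obtain ⟨h, rfl⟩ := ySec_surjective h
    simp [← MonoidalCategory.id_tensorHom, MonoidalCategory.tensorHom_comp_tensorHom]

theorem rightUnitIso_yoneda (x : K) :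
    (rightUnitIso ((yonedaMod K).obj x)).hom =
      (yonedaTensorIso x (𝟙_ K)).hom ≫ (yonedaMod K).map (ρ_ x).hom :=
  tensorObj_hom_ext fun y z g h => by
    obtain ⟨g, rfl⟩ := ySec_surjective g
    obtain ⟨h, rfl⟩ := ySec_surjective h
    simp [tensorHom_def']

/-! ### Right exactness of the tensor product -/

/-- Tensoring with `P` on the left preserves epimorphisms. -/
instance epi_tensorHom_id (P : ModCat K) {M N : ModCat K} (g : M ⟶ N) [Epi g] :
    Epi (tensorHom (𝟙 P) g) where
  left_cancellation h h' e := tensorObj_hom_ext fun y z p n => by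
    obtain ⟨m, rfl⟩ := (epi_iff_sec g).1 inferInstance z n
    simpa using congrArg (fun k => secMap k (y ⊗ z) (tmul p m)) e

/-- A morphism out of `P ⊗ M₂` which kills `P ⊗ M₁` factors through `P ⊗ M₃`, for an exact
sequence `M₁ ⟶ M₂ ⟶ M₃ ⟶ 0`. -/
theorem exists_desc_tensorLeft (P : ModCat K) {S : ShortComplex (ModCat K)} (hS : S.Exact)
    [Epi S.g] {Q : ModCat K} (k : tensorObj P S.X₂ ⟶ Q) (hk : tensorHom (𝟙 P) S.f ≫ k = 0) :
    ∃ l : tensorObj P S.X₃ ⟶ Q, tensorHom (𝟙 P) S.g ≫ l = k := by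
  have surj := (epi_iff_sec S.g).1 inferInstance
  have key : ∀ {y z : K} (p : Sec P y) (m m' : Sec S.X₂ z), secMap S.g z m = secMap S.g z m' →
      secMap k (y ⊗ z) (tmul p m) = secMap k (y ⊗ z) (tmul p m') := by
    intro y z p m m' h
    obtain ⟨n, hn⟩ := exact_sec hS (m := m - m') (by rw [map_sub, h, sub_self])
    have := congrArg (fun k => secMap k (y ⊗ z) (tmul p n)) hk
    rw [← sub_add_cancel m m', tmul_add, map_add, ← hn]
    simpa using this
  let σ : ∀ {z : K}, Sec S.X₃ z → Sec S.X₂ z := fun {z} => Function.surjInv (surj z)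
  have hσ : ∀ {z : K} (c : Sec S.X₃ z), secMap S.g z (σ c) = c :=
    fun c => Function.surjInv_eq _ c
  let φ : ∀ y z, Sec P y →+ Sec S.X₃ z →+ Sec Q (y ⊗ z) := fun y z =>
    AddMonoidHom.mk' (fun p => AddMonoidHom.mk' (fun c => secMap k (y ⊗ z) (tmul p (σ c)))
      (fun c c' => by
        rw [← map_add, ← tmul_add]
        exact key p _ _ (by simp only [map_add, hσ])))
      (fun p p' => by
        ext c
        simp only [AddMonoidHom.mk'_apply, AddMonoidHom.add_apply, add_tmul, map_add])
  have hφ : ∀ {y z} (p : Sec P y) (c : Sec S.X₃ z),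
      φ y z p c = secMap k (y ⊗ z) (tmul p (σ c)) := fun _ _ => rfl
  refine ⟨tensorDesc φ fun a b p c => ?_, tensorObj_hom_ext fun y z p m => ?_⟩
  · rw [hφ, hφ, ← secMap_res, ← tmul_res]
    exact key _ _ _ (by rw [secMap_res, hσ, hσ])
  · rw [secMap_comp, secMap_tensorHom, secMap_tensorDesc, hφ]
    exact key _ _ _ (hσ _)

/-- Tensoring with `P` on the left is right exact. -/
theorem exact_tensorLeft (P : ModCat K) {S : ShortComplex (ModCat K)} (hS : S.Exact) [Epi S.g] :
    (S.map (tensorLeftFunctor P)).Exact := by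
  have : Epi (S.map (tensorLeftFunctor P)).g := epi_tensorHom_id P S.g
  have h {Q : ModCat K} (k : tensorObj P S.X₂ ⟶ Q) (hk : tensorHom (𝟙 P) S.f ≫ k = 0) :=
    exists_desc_tensorLeft P hS k hk
  exact ShortComplex.exact_of_g_is_cokernel _ (CokernelCofork.IsColimit.ofπ _ _
    (fun k hk => (h k hk).choose) (fun k hk => (h k hk).choose_spec)
    (fun k hk l hl =>
       (cancel_epi (S.map (tensorLeftFunctor P)).g).1 (hl.trans (h k hk).choose_spec.symm)))

end tensor

/-! ### Symmetry of the tensor product -/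

section symmetry

variable {K : Type u} [Category.{v} K] [Preadditive K] [MonoidalCategory K] [SymmetricCategory K]
  [MonoidalPreadditive K] [HasBinaryBiproducts K] [EssentiallySmall.{v} K]

/-- The pairing `(m, n) ↦ n ⊗ m`, moved from `z ⊗ y` to `y ⊗ z` by the symmetry of `K`. -/
def braidPairing (M N : ModCat K) (y z : K) :
    Sec M y →+ Sec N z →+ Sec (tensorObj N M) (y ⊗ z) :=
  (res (tensorObj N M) (β_ y z).hom).compHom.comp (tmulHom N M z y).flip

@[simp]
theorem braidPairing_apply {M N : ModCat K} {y z : K} (m : Sec M y) (n : Sec N z) :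
    braidPairing M N y z m n = res (tensorObj N M) (β_ y z).hom (tmul n m) := rfl

theorem braidPairing_res (M N : ModCat K) {y z y' z' : K} (k : y' ⟶ y) (l : z' ⟶ z)
    (m : Sec M y) (n : Sec N z) :
    braidPairing M N y' z' (res M k m) (res N l n) =
      res (tensorObj N M) (k ⊗ₘ l) (braidPairing M N y z m n) := by
  simp [tmul_res, ← res_comp]

/-- The morphism `M ⊗ N ⟶ N ⊗ M` which exchanges the two factors. -/
def braidHom (M N : ModCat K) : tensorObj M N ⟶ tensorObj N M :=
  tensorDesc (braidPairing M N) (braidPairing_res M N)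

@[simp]
theorem secMap_braidHom {M N : ModCat K} {y z : K} (m : Sec M y) (n : Sec N z) :
    secMap (braidHom M N) (y ⊗ z) (tmul m n) = res (tensorObj N M) (β_ y z).hom (tmul n m) :=
  secMap_tensorDesc _ (braidPairing_res M N) _ _

theorem braidHom_braidHom (M N : ModCat K) : braidHom M N ≫ braidHom N M = 𝟙 _ :=
  tensorObj_hom_ext fun y z m n => by simp [secMap_res, ← res_comp]

/-- The symmetry of the tensor product. -/
@[simps]
def braidIso (M N : ModCat K) : tensorObj M N ≅ tensorObj N M where
  hom := braidHom M N
  inv := braidHom N M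
  hom_inv_id := braidHom_braidHom M N
  inv_hom_id := braidHom_braidHom N M

theorem braidHom_naturality {M M' N N' : ModCat K} (f : M ⟶ M') (g : N ⟶ N') :
    tensorHom f g ≫ braidHom M' N' = braidHom M N ≫ tensorHom g f :=
  tensorObj_hom_ext fun y z m n => by simp [secMap_res]

theorem braidHom_conj {M M' N N' : ModCat K} (f : M ⟶ M') (g : N ⟶ N') :
    braidHom N M ≫ tensorHom f g ≫ braidHom M' N' = tensorHom g f := by
  rw [braidHom_naturality, ← Category.assoc, braidHom_braidHom, Category.id_comp]

/-- The isomorphism `A ⊗ (M ⊗ N) ≅ M ⊗ (A ⊗ N)`. -/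
def leftCommIso (A M N : ModCat K) :
    tensorObj A (tensorObj M N) ≅ tensorObj M (tensorObj A N) :=
  (assocIso A M N).symm ≪≫ tensorIso (braidIso A M) (Iso.refl N) ≪≫ assocIso M A N

theorem leftCommIso_naturality {A A' M M' N N' : ModCat K} (f : A ⟶ A') (g : M ⟶ M')
    (h : N ⟶ N') :
    tensorHom f (tensorHom g h) ≫ (leftCommIso A' M' N').hom =
      (leftCommIso A M N).hom ≫ tensorHom g (tensorHom f h) := by
  have h₁ : tensorHom f (tensorHom g h) ≫ (assocIso A' M' N').inv =
      (assocIso A M N).inv ≫ tensorHom (tensorHom f g) h := by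
    rw [Iso.comp_inv_eq, Category.assoc, assocIso_naturality, Iso.inv_hom_id_assoc]
  simp only [leftCommIso, Iso.trans_hom, Iso.symm_hom, tensorIso_hom, braidIso_hom, Iso.refl_hom,
    Category.assoc]
  rw [← assocIso_naturality, reassoc_of% h₁, ← Category.assoc (tensorHom (tensorHom f g) h),
    ← tensorHom_comp, braidHom_naturality, Category.comp_id, ← Category.id_comp h, tensorHom_comp,
    Category.id_comp, Category.assoc]

/-- Tensoring with `P` on the right preserves epimorphisms. -/
instance epi_id_tensorHom (P : ModCat K) {M N : ModCat K} (g : M ⟶ N) [Epi g] :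
    Epi (tensorHom g (𝟙 P)) := by
  have : Epi ((braidIso M P).hom ≫ tensorHom (𝟙 P) g ≫ (braidIso P N).hom) := inferInstance
  rwa [braidIso_hom, braidIso_hom, braidHom_conj] at this

/-- Tensoring with `P` on the right is right exact. -/
theorem exact_tensorRight (P : ModCat K) {S : ShortComplex (ModCat K)} (hS : S.Exact) [Epi S.g] :
    (ShortComplex.mk (tensorHom S.f (𝟙 P)) (tensorHom S.g (𝟙 P)) (by
      rw [← tensorHom_comp, S.zero, zero_tensorHom])).Exact :=
  ShortComplex.exact_of_iso
    (ShortComplex.isoMk (braidIso P S.X₁) (braidIso P S.X₂) (braidIso P S.X₃)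
      (braidHom_naturality _ _).symm (braidHom_naturality _ _).symm) (exact_tensorLeft P hS)

end symmetry

/-! ### Finitely presented modules -/

section presentations

variable {K : Type u} [Category.{v} K] [Preadditive K]

/-- The module with one generator over `x` and one relation `a : y ⟶ x`: the cokernel of
`ŷ ⟶ x̂`. -/
abbrev coker {x y : K} (a : y ⟶ x) : ModCat K := cokernel ((yonedaMod K).map a)

/-- The presentation `ŷ ⟶ x̂ ⟶ coker a`. -/
abbrev cokerSequence {x y : K} (a : y ⟶ x) : ShortComplex (ModCat K) :=
  ShortComplex.mk ((yonedaMod K).map a) (cokernel.π _) (cokernel.condition _)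

theorem cokerSequence_exact {x y : K} (a : y ⟶ x) : (cokerSequence a).Exact :=
  ShortComplex.exact_cokernel _

theorem finitelyPresented_coker {x y : K} (a : y ⟶ x) : finitelyPresented K (coker a) :=
  ⟨x, y, (yonedaMod K).map a, cokernel.π _, cokernel.condition _, inferInstance,
    cokerSequence_exact a⟩

theorem finitelyPresented_of_iso {M N : ModCat K} (e : M ≅ N) (h : finitelyPresented K M) :
    finitelyPresented K N := by
  obtain ⟨x, y, a, p, w, hp, hex⟩ := h
  refine ⟨x, y, a, p ≫ e.hom, by rw [reassoc_of% w, zero_comp], inferInstance, ?_⟩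
  exact ShortComplex.exact_of_iso
    (ShortComplex.isoMk (S₁ := ShortComplex.mk a p w) (Iso.refl _) (Iso.refl _) e) hex

theorem finitelyPresented_yoneda (x : K) : finitelyPresented K ((yonedaMod K).obj x) :=
  ⟨x, x, 0, 𝟙 _, zero_comp, inferInstance,
    (exact_iff_sec _).2 fun _ m hm => ⟨0, (hm : m = 0).symm⟩⟩

/-- A morphism `z ⟶ x` factors through `a : y ⟶ x` if it dies in the cokernel of `ŷ ⟶ x̂`. -/
theorem exists_factor_of_coker {x y z : K} (a : y ⟶ x) (k : z ⟶ x)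
    (h : (yonedaMod K).map k ≫ cokernel.π ((yonedaMod K).map a) = 0) :
    ∃ l : z ⟶ y, l ≫ a = k := by
  obtain ⟨l, hl⟩ := yoneda_lift_exact (cokerSequence_exact a) ((yonedaMod K).map k) h
  obtain ⟨l, rfl⟩ := yoneda_map_surjective l
  refine ⟨l, ySec_injective ?_⟩
  simpa using congrArg (fun h => secMap h z (ySec (𝟙 z))) hl

/-- The cokernel of a morphism of finitely presented modules is finitely presented. -/
theorem finitelyPresented_of_exact [HasBinaryBiproducts K] {S : ShortComplex (ModCat K)}
    (hS : S.Exact) [Epi S.g] (h₁ : finitelyPresented K S.X₁) (h₂ : finitelyPresented K S.X₂) :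
    finitelyPresented K S.X₃ := by
  obtain ⟨x₁, -, -, p₁, -, hp₁, -⟩ := h₁
  obtain ⟨x₂, y₂, a₂, p₂, w₂, hp₂, hex₂⟩ := h₂
  obtain ⟨l, hl⟩ := yoneda_lift p₂ (p₁ ≫ S.f)
  obtain ⟨l, rfl⟩ := yoneda_map_surjective l
  obtain ⟨a, rfl⟩ := yoneda_map_surjective a₂
  have w : (yonedaMod K).map (biprod.desc l a) ≫ p₂ ≫ S.g = 0 := by
    have h₁ : (yonedaMod K).map (biprod.fst ≫ l : x₁ ⊞ y₂ ⟶ _) ≫ p₂ ≫ S.g = 0 := by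
      rw [Functor.map_comp, Category.assoc, reassoc_of% hl, S.zero, comp_zero, comp_zero]
    have h₂ : (yonedaMod K).map (biprod.snd ≫ a : x₁ ⊞ y₂ ⟶ _) ≫ p₂ ≫ S.g = 0 := by
      rw [Functor.map_comp, Category.assoc, reassoc_of% w₂, zero_comp, comp_zero]
    rw [yoneda_comp_eq_zero_iff] at h₁ h₂ ⊢
    rw [biprod.desc_eq, res_add_hom, h₁, h₂, add_zero]
  refine ⟨x₂, x₁ ⊞ y₂, (yonedaMod K).map (biprod.desc l a), p₂ ≫ S.g, w, epi_comp _ _, ?_⟩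
  refine (exact_iff_sec _).2 fun z m hm => ?_
  obtain ⟨n, hn⟩ := exact_sec hS (m := secMap p₂ z m) hm
  obtain ⟨s, rfl⟩ := (epi_iff_sec p₁).1 inferInstance z n
  obtain ⟨s, rfl⟩ := ySec_surjective s
  obtain ⟨r, hr⟩ := exact_sec hex₂
    (m := m - secMap ((yonedaMod K).map l) z (ySec s)) (by
      change secMap p₂ z _ = 0
      rw [map_sub, ← hn, ← secMap_comp, ← secMap_comp, hl, sub_self])
  obtain ⟨r, rfl⟩ := ySec_surjective r
  refine ⟨ySec (biprod.lift s r), ?_⟩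
  change secMap ((yonedaMod K).map a) z _ = _ at hr
  change secMap ((yonedaMod K).map _) z _ = _
  rw [secMap_yoneda, biprod.lift_desc, ySec_add, ← secMap_yoneda, ← secMap_yoneda, hr]
  abel

end presentations

section tensor

variable {K : Type u} [Category.{v} K] [Preadditive K] [MonoidalCategory K] [SymmetricCategory K]
  [MonoidalPreadditive K] [HasBinaryBiproducts K] [EssentiallySmall.{v} K]

/-- Finitely presented modules are closed under tensor products. -/
theorem finitelyPresented_tensorObj {M N : ModCat K} (hM : finitelyPresented K M)
    (hN : finitelyPresented K N) : finitelyPresented K (tensorObj M N) := by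
  have hy : ∀ x : K, finitelyPresented K (tensorObj ((yonedaMod K).obj x) N) := by
    intro x
    obtain ⟨x', y', a, p, w, hp, hex⟩ := hN
    let S := (ShortComplex.mk a p w).map (tensorLeftFunctor ((yonedaMod K).obj x))
    have : Epi S.g := epi_tensorHom_id _ p
    have hS : S.Exact := exact_tensorLeft ((yonedaMod K).obj x) hex
    exact finitelyPresented_of_exact hS
      (finitelyPresented_of_iso (yonedaTensorIso x y').symm (finitelyPresented_yoneda _))
      (finitelyPresented_of_iso (yonedaTensorIso x x').symm (finitelyPresented_yoneda _))
  obtain ⟨x, y, a, p, w, hp, hex⟩ := hM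
  have hS := exact_tensorRight N hex
  exact finitelyPresented_of_exact hS (hy y) (hy x)

end tensor

section coherence

open Pretriangulated

variable {K : Type u} [Category.{v} K] [HasZeroObject K] [HasShift K ℤ] [Preadditive K]
  [∀ n : ℤ, (shiftFunctor K n).Additive] [Pretriangulated K]

/-- `mod-K` is coherent: the kernel of a morphism `x̂ ⟶ N` with `N` finitely presented is covered
by a representable module. The cover is a weak kernel in `K`, obtained from a distinguished
triangle. -/
theorem exists_weakKernel {N : ModCat K} (hN : finitelyPresented K N) {x : K}
    (φ : (yonedaMod K).obj x ⟶ N) :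
    ∃ (w : K) (k : w ⟶ x) (h : (yonedaMod K).map k ≫ φ = 0), (ShortComplex.mk _ _ h).Exact := by
  obtain ⟨x', y', a, p, w, hp, hex⟩ := hN
  obtain ⟨a, rfl⟩ := yoneda_map_surjective a
  obtain ⟨l, hl⟩ := yoneda_lift p φ
  obtain ⟨l, rfl⟩ := yoneda_map_surjective l
  obtain ⟨z, i, j, hT⟩ := distinguished_cocone_triangle₁ (biprod.desc l a)
  have hi : i ≫ biprod.desc l a = 0 := comp_distTriang_mor_zero₁₂ _ hT
  have hi' : (i ≫ biprod.fst) ≫ l = (-(i ≫ biprod.snd)) ≫ a := by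
    rw [biprod.desc_eq, Preadditive.comp_add] at hi
    rw [Preadditive.neg_comp, Category.assoc, Category.assoc]
    exact eq_neg_of_add_eq_zero_left hi
  refine ⟨z, i ≫ biprod.fst, ?_, ?_⟩
  · rw [← hl, ← Category.assoc, ← Functor.map_comp, hi', Functor.map_comp, Category.assoc, w,
      comp_zero]
  · refine (exact_iff_sec _).2 fun t m hm => ?_
    obtain ⟨m, rfl⟩ := ySec_surjective m
    obtain ⟨n, hn⟩ := exact_sec hex (m := secMap ((yonedaMod K).map l) t (ySec m)) (by
      change secMap p t _ = 0
      rw [← secMap_comp, hl]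
      exact hm)
    obtain ⟨n, rfl⟩ := ySec_surjective n
    have hn' : n ≫ a = m ≫ l := ySec_injective hn
    obtain ⟨(s : t ⟶ z), hs⟩ := Triangle.coyoneda_exact₂ _ hT (biprod.lift m (-n)) (by
      change biprod.lift m (-n) ≫ biprod.desc l a = 0
      rw [biprod.lift_desc, Preadditive.neg_comp, hn', add_neg_cancel])
    refine ⟨ySec s, ?_⟩
    change ySec (s ≫ i ≫ biprod.fst) = _
    have : biprod.lift m (-n) = s ≫ i := hs
    rw [← Category.assoc, ← this, biprod.lift_fst]

/-- A module which is both a quotient of a representable module and a submodule of a finitely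
presented module is finitely presented. -/
theorem finitelyPresented_of_epi_mono {M N : ModCat K} {x : K} (p : (yonedaMod K).obj x ⟶ M)
    [Epi p] (i : M ⟶ N) [Mono i] (hN : finitelyPresented K N) : finitelyPresented K M := by
  obtain ⟨w, k, h, hex⟩ := exists_weakKernel hN (p ≫ i)
  have h' : (yonedaMod K).map k ≫ p = 0 := by
    rw [← cancel_mono i, Category.assoc, h, zero_comp]
  refine ⟨x, w, (yonedaMod K).map k, p, h', inferInstance, (exact_iff_sec _).2 fun z m hm => ?_⟩
  refine exact_sec hex (m := m) ?_
  change secMap i z (secMap p z m) = 0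
  exact (congrArg (secMap i z) hm).trans (map_zero _)

/-- A submodule of a finitely presented module which is the kernel of an epimorphism onto a
finitely presented module is finitely presented. -/
theorem finitelyPresented_of_shortExact {S : ShortComplex (ModCat K)} (hS : S.ShortExact)
    (h₂ : finitelyPresented K S.X₂) (h₃ : finitelyPresented K S.X₃) :
    finitelyPresented K S.X₁ := by
  have := hS.mono_f
  have h₂' := h₂
  obtain ⟨x, -, -, p, -, hp, -⟩ := h₂
  obtain ⟨w, k, h, hex⟩ := exists_weakKernel h₃ (p ≫ S.g)
  obtain ⟨q, hq⟩ := yoneda_lift_exact hS.exact ((yonedaMod K).map k ≫ p)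
    (by rw [Category.assoc, h])
  have : Epi q := (epi_iff_sec q).2 fun z m => by
    obtain ⟨s, hs⟩ := (epi_iff_sec p).1 inferInstance z (secMap S.f z m)
    obtain ⟨t, ht⟩ := exact_sec hex (m := s) (by
      change secMap S.g z (secMap p z s) = 0
      rw [hs, ← secMap_comp, S.zero, secMap_zero])
    refine ⟨t, (mono_iff_sec S.f).1 inferInstance z ?_⟩
    rw [← secMap_comp, hq, secMap_comp, ← hs]
    exact congrArg (secMap p z) ht
  exact finitelyPresented_of_epi_mono q S.f h₂'

end coherence

/-! ### Submodules -/

section submodules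

variable {K : Type u} [Category.{v} K] [Preadditive K]

/-- The submodule of `M` given by subgroups of the groups of sections which are stable under
restriction. -/
def subMod (M : ModCat K) (S : ∀ y, AddSubgroup (Sec M y))
    (hS : ∀ {z y : K} (k : z ⟶ y) (m : Sec M y), m ∈ S y → res M k m ∈ S z) : ModCat K where
  obj :=
    { obj := fun y => AddCommGrpCat.of (S y.unop)
      map := fun {y z} k => AddCommGrpCat.ofHom
        (((res M k.unop).comp (S y.unop).subtype).codRestrict (S z.unop)
          fun m => hS k.unop m m.2)
      map_id := fun y => AddCommGrpCat.ext fun (m : S y.unop) =>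
        Subtype.ext (res_id M y.unop m.1)
      map_comp := fun {y _ _} k l => AddCommGrpCat.ext fun (m : S y.unop) =>
        Subtype.ext (res_comp M l.unop k.unop m.1) }
  property := ⟨fun {y _ k l} => AddCommGrpCat.ext fun (m : S y.unop) =>
    Subtype.ext (res_add_hom M k.unop l.unop m.1)⟩

variable {M : ModCat K} {S : ∀ y, AddSubgroup (Sec M y)}
  (hS : ∀ {z y : K} (k : z ⟶ y) (m : Sec M y), m ∈ S y → res M k m ∈ S z)

/-- The inclusion of a submodule. -/
def subModι : subMod M S hS ⟶ M :=
  homOfSec (M := subMod M S hS) (fun y => (S y).subtype) fun _ _ => rfl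

/-- A morphism with values in a submodule factors through it. -/
def subModLift {N : ModCat K} (g : N ⟶ M) (hg : ∀ y n, secMap g y n ∈ S y) : N ⟶ subMod M S hS :=
  homOfSec (N := subMod M S hS) (fun y => (secMap g y).codRestrict (S y) (hg y))
    fun k n => Subtype.ext (secMap_res g k n)

theorem subModLift_ι {N : ModCat K} (g : N ⟶ M) (hg : ∀ y n, secMap g y n ∈ S y) :
    subModLift hS g hg ≫ subModι hS = g := rfl

theorem secMap_subModι_mem (y : K) (m : Sec (subMod M S hS) y) : secMap (subModι hS) y m ∈ S y :=
  m.2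

instance : Mono (subModι hS) := (mono_iff_sec _).2 fun y => (S y).subtype_injective

end submodules

/-! ### Torsion sections -/

section torsion

variable {K : Type u} [Category.{v} K] [Preadditive K]

/-- A section `m` of `M` over `x` is `B`-torsion if the corresponding morphism `x̂ ⟶ M` factors
through a quotient of `x̂` by a morphism `ŷ ⟶ x̂` which belongs to `B`. -/
def IsTorsionSec (B : ObjectProperty (ModCat K)) {M : ModCat K} {x : K} (m : Sec M x) : Prop :=
  ∃ (y : K) (a : y ⟶ x), B (coker a) ∧ res M a m = 0

theorem IsTorsionSec.map {B : ObjectProperty (ModCat K)} {M : ModCat K} {x : K}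
    {m : Sec M x} (hm : IsTorsionSec B m) {N : ModCat K} (g : M ⟶ N) :
    IsTorsionSec B (secMap g x m) := by
  obtain ⟨y, a, ha, h⟩ := hm
  exact ⟨y, a, ha, by rw [← secMap_res, h, map_zero]⟩

/-- The modules all of whose sections are `B`-torsion. -/
def torsionModules (B : ObjectProperty (ModCat K)) : ObjectProperty (ModCat K) := fun M =>
  ∀ (x : K) (m : Sec M x), IsTorsionSec B m

end torsion

/-! ### Serre ideals of finitely presented modules -/

section ideals

variable {K : Type u} [Category.{v} K] [EssentiallySmall.{v} K] [HasZeroObject K] [HasShift K ℤ]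
  [Preadditive K] [∀ n : ℤ, (shiftFunctor K n).Additive] [Pretriangulated K]
  [MonoidalCategory K] [MonoidalPreadditive K] {B : ObjectProperty (ModCat K)}

namespace IsSerreTensorIdeal

theorem of_isZero (hB : IsSerreTensorIdeal B) {M : ModCat K} (hM : IsZero M) : B M := by
  obtain ⟨Z, hZ, h⟩ := hB.zero
  have hZ' := hB.le_finitelyPresented Z h
  have : Mono (0 : M ⟶ Z) := hM.mono _
  have : Epi (0 : Z ⟶ Z) := hZ.epi _
  have hS : (ShortComplex.mk (0 : M ⟶ Z) (0 : Z ⟶ Z) (by simp)).ShortExact :=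
    { exact := ShortComplex.exact_of_isZero_X₂ _ hZ }
  exact ((hB.shortExact _ hS (finitelyPresented_of_iso (hZ.iso hM) hZ') hZ' hZ').1 h).1

theorem of_mono (hB : IsSerreTensorIdeal B) {M N : ModCat K} (i : M ⟶ N) [Mono i]
    (hM : finitelyPresented K M) (hN : B N) : B M := by
  have hN' := hB.le_finitelyPresented N hN
  have hS : (ShortComplex.mk i (cokernel.π i) (cokernel.condition i)).ShortExact :=
    { exact := ShortComplex.exact_cokernel i }
  exact ((hB.shortExact _ hS hM hN' (finitelyPresented_of_exact hS.exact hM hN')).1 hN).1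

theorem of_epi (hB : IsSerreTensorIdeal B) {M N : ModCat K} (p : M ⟶ N) [Epi p]
    (hN : finitelyPresented K N) (hM : B M) : B N := by
  have hM' := hB.le_finitelyPresented M hM
  have hS : (ShortComplex.mk (kernel.ι p) p (kernel.condition p)).ShortExact :=
    { exact := ShortComplex.exact_kernel p }
  exact ((hB.shortExact _ hS (finitelyPresented_of_shortExact hS hM' hN) hM' hN).1 hM).2

theorem of_iso (hB : IsSerreTensorIdeal B) {M N : ModCat K} (e : M ≅ N) (hM : B M) : B N :=
  hB.of_epi e.hom (finitelyPresented_of_iso e (hB.le_finitelyPresented M hM)) hM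

theorem of_shortExact (hB : IsSerreTensorIdeal B) {S : ShortComplex (ModCat K)} (hS : S.ShortExact)
    (h₂ : finitelyPresented K S.X₂) (h₁ : B S.X₁) (h₃ : B S.X₃) : B S.X₂ :=
  (hB.shortExact S hS (hB.le_finitelyPresented _ h₁) h₂ (hB.le_finitelyPresented _ h₃)).2 ⟨h₁, h₃⟩

/-- A `⊗`-ideal is proper if it does not contain the unit. -/
theorem eq_finitelyPresented_of_unit (hB : IsSerreTensorIdeal B)
    (h : B ((yonedaMod K).obj (𝟙_ K))) : B = finitelyPresented K :=
  le_antisymm hB.le_finitelyPresented fun M hM =>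
    hB.of_iso (rightUnitIso M) (hB.tensor M _ hM h)

/-- The image of `x̂` in an object of `B` is the cokernel of some `ŵ ⟶ x̂`, and belongs to `B`. -/
theorem exists_coker (hB : IsSerreTensorIdeal B) {N : ModCat K} (hN : B N) {x : K}
    (φ : (yonedaMod K).obj x ⟶ N) :
    ∃ (w : K) (k : w ⟶ x), (yonedaMod K).map k ≫ φ = 0 ∧ B (coker k) := by
  obtain ⟨w, k, h, hex⟩ := exists_weakKernel (hB.le_finitelyPresented N hN) φ
  refine ⟨w, k, h, ?_⟩
  have : Mono (cokernel.desc _ φ h) := (mono_iff_sec _).2 fun z => by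
    rw [injective_iff_map_eq_zero]
    intro m hm
    obtain ⟨s, rfl⟩ := (epi_iff_sec (cokernel.π ((yonedaMod K).map k))).1 inferInstance z m
    rw [← secMap_comp, cokernel.π_desc] at hm
    obtain ⟨t, rfl⟩ := exact_sec hex (m := s) hm
    change secMap _ z (secMap ((yonedaMod K).map k) z t) = 0
    rw [← secMap_comp, cokernel.condition, secMap_zero]
  exact hB.of_mono (cokernel.desc _ φ h) (finitelyPresented_coker k) hN

/-- Morphisms of `K` whose cokernel in `mod-K` belongs to `B` are closed under composition. -/
theorem coker_comp (hB : IsSerreTensorIdeal B) {x y z : K} {b : z ⟶ y} {a : y ⟶ x}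
    (hb : B (coker b)) (ha : B (coker a)) : B (coker (b ≫ a)) := by
  have w : (yonedaMod K).map (b ≫ a) ≫ cokernel.π ((yonedaMod K).map a) = 0 := by
    rw [Functor.map_comp, Category.assoc, cokernel.condition, comp_zero]
  let p : coker (b ≫ a) ⟶ coker a := cokernel.desc _ _ w
  have hp : cokernel.π _ ≫ p = cokernel.π _ := cokernel.π_desc _ _ w
  have : Epi p := by
    have : Epi (cokernel.π _ ≫ p) := by rw [hp]; infer_instance
    exact epi_of_epi (cokernel.π _) p
  have hS : (ShortComplex.mk (kernel.ι p) p (kernel.condition p)).ShortExact :=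
    { exact := ShortComplex.exact_kernel p }
  have hfp := finitelyPresented_of_shortExact hS (finitelyPresented_coker _)
    (finitelyPresented_coker _)
  -- the kernel of `coker (b ≫ a) ⟶ coker a` is a quotient of `coker b`
  let q₀ : (yonedaMod K).obj y ⟶ kernel p :=
    kernel.lift p ((yonedaMod K).map a ≫ cokernel.π _) (by
      rw [Category.assoc, hp, cokernel.condition])
  have hq₀ : q₀ ≫ kernel.ι p = (yonedaMod K).map a ≫ cokernel.π _ := kernel.lift_ι _ _ _
  have hbq : (yonedaMod K).map b ≫ q₀ = 0 := by
    rw [← cancel_mono (kernel.ι p), Category.assoc, hq₀, ← Category.assoc, ← Functor.map_comp,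
      cokernel.condition, zero_comp]
  have : Epi q₀ := (epi_iff_sec q₀).2 fun t m => by
    obtain ⟨s, hs⟩ := (epi_iff_sec (cokernel.π ((yonedaMod K).map (b ≫ a)))).1 inferInstance t
      (secMap (kernel.ι p) t m)
    obtain ⟨r, hr⟩ := exact_sec (cokerSequence_exact a) (m := s) (by
      change secMap (cokernel.π _) t s = 0
      rw [← hp, secMap_comp, hs, ← secMap_comp, kernel.condition, secMap_zero])
    refine ⟨r, (mono_iff_sec (kernel.ι p)).1 inferInstance t ?_⟩
    rw [← secMap_comp, hq₀, secMap_comp, ← hs]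
    exact congrArg _ hr
  have : Epi (cokernel.desc _ q₀ hbq) := by
    have : Epi (cokernel.π _ ≫ cokernel.desc _ q₀ hbq) := by
      rw [cokernel.π_desc]; infer_instance
    exact epi_of_epi (cokernel.π _) _
  exact hB.of_shortExact hS (finitelyPresented_coker _)
    (hB.of_epi (cokernel.desc _ q₀ hbq) hfp hb) ha

end IsSerreTensorIdeal

/-! ### The localizing subcategory generated by a Serre ideal -/

section

variable {M : ModCat K} {x : K}

theorem isTorsionSec_zero (hB : IsSerreTensorIdeal B) : IsTorsionSec B (0 : Sec M x) :=
  ⟨x, 𝟙 x, hB.of_isZero (by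
    have : Epi ((yonedaMod K).map (𝟙 x)) := inferInstance
    exact isZero_cokernel_of_epi _), map_zero _⟩

theorem IsTorsionSec.res (hB : IsSerreTensorIdeal B) {m : Sec M x} (hm : IsTorsionSec B m) {x' : K}
    (k : x' ⟶ x) : IsTorsionSec B (TTNilpotence.res M k m) := by
  obtain ⟨y, a, ha, h⟩ := hm
  obtain ⟨w, b, hb, hb'⟩ := hB.exists_coker ha
    ((yonedaMod K).map k ≫ cokernel.π ((yonedaMod K).map a))
  obtain ⟨l, hl⟩ := exists_factor_of_coker a (b ≫ k)
    (by rw [Functor.map_comp, Category.assoc, hb])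
  exact ⟨w, b, hb', by rw [← res_comp, ← hl, res_comp, h, map_zero]⟩

theorem IsTorsionSec.add (hB : IsSerreTensorIdeal B) {m m' : Sec M x} (hm : IsTorsionSec B m)
    (hm' : IsTorsionSec B m') : IsTorsionSec B (m + m') := by
  obtain ⟨y, a, ha, h⟩ := hm
  obtain ⟨z, b, hb, h'⟩ := hm'.res hB a
  exact ⟨z, b ≫ a, hB.coker_comp hb ha, by
    rw [map_add, res_comp, res_comp, h, h', map_zero, add_zero]⟩

end

/-- The subgroup of `B`-torsion sections. -/
def torsionSubgroup (hB : IsSerreTensorIdeal B) (M : ModCat K) (x : K) : AddSubgroup (Sec M x) where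
  carrier := {m | IsTorsionSec B m}
  zero_mem' := isTorsionSec_zero hB
  add_mem' h h' := h.add hB h'
  neg_mem' := by
    rintro m ⟨y, a, ha, h⟩
    exact ⟨y, a, ha, by rw [map_neg, h, neg_zero]⟩

theorem torsionModules_isSerreClass (hB : IsSerreTensorIdeal B) :
    (torsionModules B).IsSerreClass where
  exists_zero := by
    obtain ⟨Z, hZ⟩ := HasZeroObject.zero (C := ModCat K)
    refine ⟨Z, hZ, fun x m => ?_⟩
    have : m = 0 := congrArg (fun k => secMap k x m) (hZ.eq_of_src (𝟙 Z) 0)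
    exact this ▸ isTorsionSec_zero hB
  prop_of_mono {M N} f _ hN x m := by
    obtain ⟨y, a, ha, h⟩ := hN x (secMap f x m)
    refine ⟨y, a, ha, (mono_iff_sec f).1 inferInstance y ?_⟩
    rw [secMap_res, h, map_zero]
  prop_of_epi {M N} f _ hM x n := by
    obtain ⟨m, rfl⟩ := (epi_iff_sec f).1 inferInstance x n
    exact (hM x m).map f
  prop_X₂_of_shortExact {S} hS h₁ h₃ x m := by
    have := hS.mono_f
    obtain ⟨y, a, ha, h⟩ := h₃ x (secMap S.g x m)
    rw [← secMap_res] at h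
    obtain ⟨n, hn⟩ := exact_sec hS.exact h
    obtain ⟨z, b, hb, h'⟩ := h₁ y n
    exact ⟨z, b ≫ a, hB.coker_comp hb ha, by
      rw [res_comp, ← hn, ← secMap_res, h', map_zero]⟩

theorem torsionModules_coproduct (hB : IsSerreTensorIdeal B) (J : Type v) :
    (torsionModules B).IsClosedUnderColimitsOfShape (Discrete J) where
  colimitsOfShape_le := by
    rintro M ⟨p⟩
    have hS : ∀ {z y : K} (k : z ⟶ y) (m : Sec M y), m ∈ torsionSubgroup hB M y →
      res M k m ∈ torsionSubgroup hB M z := fun k m hm => IsTorsionSec.res hB hm k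
    -- the structure maps of the coproduct land in the torsion submodule, which is thus everything
    let c : Cocone p.diag :=
      { pt := subMod M (torsionSubgroup hB M) hS
        ι := Discrete.natTrans fun j => subModLift hS (p.ι.app j) fun y n =>
          (p.prop_diag_obj j y n).map (p.ι.app j) }
    have hc : p.isColimit.desc c ≫ subModι hS = 𝟙 M := p.isColimit.hom_ext fun j => by
      rw [p.isColimit.fac_assoc]
      exact (subModLift_ι hS _ _).trans (Category.comp_id _).symm
    intro x m
    have : secMap (subModι hS) x (secMap (p.isColimit.desc c) x m) = m :=
      congrArg (fun k => secMap k x m) hc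
    rw [← this]
    exact secMap_subModι_mem hS x _

theorem le_torsionModules (hB : IsSerreTensorIdeal B) : B ≤ torsionModules B := fun M hM x m => by
  obtain ⟨w, k, h, hk⟩ := hB.exists_coker hM (ofSec m)
  refine ⟨w, k, hk, ?_⟩
  simpa [yoneda_comp_eq_zero_iff] using h

/-- A morphism `f : x̂ ⟶ M` which vanishes in the Gabriel quotient by `⟨B⟩` factors through a
quotient of `x̂` which belongs to `B`. -/
theorem exists_coker_of_gabrielQuotient_map_eq_zero (hB : IsSerreTensorIdeal B) {x : K}
    {M : ModCat K} (f : (yonedaMod K).obj x ⟶ M) (hf : (gabrielQuotient B).map f = 0) :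
    ∃ (y : K) (a : y ⟶ x), B (coker a) ∧ (yonedaMod K).map a ≫ f = 0 := by
  have h := (ObjectProperty.SerreClassLocalization.map_eq_zero_iff _
    (localizingClosure B) f).1 hf _
    (torsionModules_isSerreClass hB) (torsionModules_coproduct hB) (le_torsionModules hB)
  obtain ⟨y, a, ha, h⟩ := (h x (secMap (Abelian.factorThruImage f) x (ySec (𝟙 x)))).map
    (Abelian.image.ι f)
  refine ⟨y, a, ha, (yoneda_comp_eq_zero_iff a f).2 ?_⟩
  rwa [← secMap_comp, Abelian.image.fac] at h

end ideals

/-! ### Morphisms killed by tensor powers of a morphism into a flat module -/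

section killed

variable {K : Type u} [Category.{v} K] [Preadditive K] [MonoidalCategory K]
  [MonoidalPreadditive K] [HasBinaryBiproducts K] [EssentiallySmall.{v} K]

/-- `TensorKilled f h` says that `f ⊗ (f ⊗ ⋯ (f ⊗ h)) = 0` for some number of factors `f`.
In this inductive form no reindexing of iterated tensor products is ever needed. -/
inductive TensorKilled {X F : ModCat K} (f : X ⟶ F) : ∀ {M N : ModCat K}, (M ⟶ N) → Prop
  | of_eq_zero {M N : ModCat K} {h : M ⟶ N} (w : h = 0) : TensorKilled f h
  | of_tensor {M N : ModCat K} {h : M ⟶ N} (w : TensorKilled f (tensorHom f h)) : TensorKilled f h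

namespace TensorKilled

variable {X F : ModCat K} {f : X ⟶ F}

theorem comp {M N : ModCat K} {h : M ⟶ N} (w : TensorKilled f h) {M' N' : ModCat K}
    (a : M' ⟶ M) (b : N ⟶ N') : TensorKilled f (a ≫ h ≫ b) := by
  induction w generalizing M' N' with
  | of_eq_zero w => exact of_eq_zero (by rw [w, zero_comp, comp_zero])
  | of_tensor w ih =>
    refine of_tensor ?_
    have := ih (tensorHom (𝟙 X) a) (tensorHom (𝟙 F) b)
    rwa [← tensorHom_comp, ← tensorHom_comp, Category.comp_id, Category.id_comp] at this

theorem of_epi_comp {M N P : ModCat K} {e : P ⟶ M} [Epi e] {h : M ⟶ N}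
    (w : TensorKilled f (e ≫ h)) : TensorKilled f h := by
  generalize hk : e ≫ h = k at w
  induction w generalizing M with
  | of_eq_zero w => exact of_eq_zero (by rw [← cancel_epi e, hk, w, comp_zero])
  | of_tensor w ih =>
    refine of_tensor (ih (e := tensorHom (𝟙 X) e) (h := tensorHom f h) ?_)
    rw [← tensorHom_comp, Category.id_comp, hk]

end TensorKilled

end killed

section ideal

variable {K : Type u} [Category.{v} K] [Preadditive K] [MonoidalCategory K] [SymmetricCategory K]
  [MonoidalPreadditive K] [HasBinaryBiproducts K] [EssentiallySmall.{v} K]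
  {X F : ModCat K} {f : X ⟶ F}

namespace TensorKilled

/-- By symmetry, the factors `f` can be moved past a module `P`. -/
theorem tensor_left {M N : ModCat K} {h : M ⟶ N} (w : TensorKilled f h) (P : ModCat K) :
    TensorKilled f (tensorHom (𝟙 P) h) := by
  induction w with
  | of_eq_zero w => exact of_eq_zero (by rw [w, tensorHom_zero])
  | of_tensor w ih =>
    refine of_tensor ?_
    have := ih.comp (leftCommIso _ _ _).hom (leftCommIso _ _ _).inv
    rwa [← Category.assoc, ← leftCommIso_naturality, Category.assoc, Iso.hom_inv_id,
      Category.comp_id] at this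

/-- If `h : M ⟶ N₂` is killed modulo `N₁`, and `N₁` is killed, then so is `h`. Once enough factors
`f` kill `h` modulo `N₁`, flatness of `F` makes the resulting morphism factor through
`F ⊗ ⋯ ⊗ F ⊗ N₁`, which is killed by further factors. -/
theorem of_exact (hF : IsTensorFlat F) {M N₁ N₂ N₃ : ModCat K} {i : N₁ ⟶ N₂} {p : N₂ ⟶ N₃}
    {z : i ≫ p = 0} (hS : (ShortComplex.mk i p z).Exact) [Mono i] (h₁ : TensorKilled f (𝟙 N₁))
    {h : M ⟶ N₂} (w : TensorKilled f (h ≫ p)) : TensorKilled f h := by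
  generalize hk : h ≫ p = k at w
  induction w generalizing N₁ N₂ with
  | of_eq_zero w =>
    have := h₁.comp (hS.lift h (hk.trans w)) i
    rw [Category.id_comp] at this
    rwa [show hS.lift h (hk.trans w) ≫ i = h from hS.lift_f _ _] at this
  | of_tensor w ih =>
    have : PreservesFiniteLimits (tensorLeftFunctor F) := hF.1
    have : PreservesFiniteColimits (tensorLeftFunctor F) := hF.2
    have : Mono (tensorHom (𝟙 F) i) := inferInstanceAs (Mono ((tensorLeftFunctor F).map i))
    have z' : tensorHom (𝟙 F) i ≫ tensorHom (𝟙 F) p = 0 := by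
      rw [← tensorHom_comp, z, tensorHom_zero]
    refine of_tensor (ih (i := tensorHom (𝟙 F) i) (p := tensorHom (𝟙 F) p) (z := z')
      (hS.map (tensorLeftFunctor F)) ?_ ?_)
    · rw [← tensorHom_id]
      exact h₁.tensor_left F
    · rw [← tensorHom_comp, Category.comp_id, hk]

theorem of_comp_mono (hF : IsTensorFlat F) {M N P : ModCat K} {h : M ⟶ N} (i : N ⟶ P) [Mono i]
    (w : TensorKilled f (h ≫ i)) : TensorKilled f h := by
  obtain ⟨Z, hZ⟩ := HasZeroObject.zero (C := ModCat K)
  have : Mono (0 : Z ⟶ N) := hZ.mono _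
  exact of_exact (z := zero_comp) hF ((ShortComplex.exact_iff_mono _ rfl).2 ‹Mono i›)
    (of_eq_zero (hZ.eq_of_src _ _)) w

end TensorKilled

/-- `f ⊗ f^{⊗ m}` and `f^{⊗ (m + 1)}` agree up to isomorphism. -/
theorem exists_tensorPowMap_succ (f : X ⟶ F) (m : ℕ) :
    ∃ (a : tensorPow X (m + 1) ⟶ tensorObj X (tensorPow X m))
      (b : tensorObj F (tensorPow F m) ⟶ tensorPow F (m + 1)),
      a ≫ tensorHom f (tensorPowMap f m) ≫ b = tensorPowMap f (m + 1) := by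
  match m with
  | 0 => exact ⟨(rightUnitIso X).inv, (rightUnitIso F).hom,
      (Iso.inv_comp_eq _).2 (rightUnitIso_naturality f)⟩
  | m + 1 => exact ⟨braidHom _ _, braidHom _ _, braidHom_conj f (tensorPowMap f (m + 1))⟩

/-- If some tensor power `f^{⊗ m}` factors through a killed morphism, then `f` is `⊗`-nilpotent. For
`m = 0` this applies to the identity of `1̂`. -/
theorem TensorKilled.isTensorNilpotent {M N : ModCat K} {h : M ⟶ N} (w : TensorKilled f h) (m : ℕ)
    (a : tensorPow X m ⟶ M) (b : N ⟶ tensorPow F m) (e : a ≫ h ≫ b = tensorPowMap f m) :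
    IsTensorNilpotent f := by
  induction w generalizing m with
  | of_eq_zero w =>
    rw [w, zero_comp, comp_zero] at e
    obtain ⟨a', b', e'⟩ := exists_tensorPowMap_succ f m
    exact ⟨m + 1, by omega, by rw [← e', ← e, tensorHom_zero, zero_comp, comp_zero]⟩
  | of_tensor w ih =>
    obtain ⟨a', b', e'⟩ := exists_tensorPowMap_succ f m
    refine ih (m + 1) (a' ≫ tensorHom (𝟙 X) a) (tensorHom (𝟙 F) b ≫ b') ?_
    rw [← e', ← e, Category.assoc, ← Category.assoc (tensorHom f _), ← tensorHom_comp,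
      ← Category.assoc (tensorHom (𝟙 X) a), ← tensorHom_comp, Category.comp_id, Category.id_comp]

/-- The finitely presented modules `M` such that `f ⊗ ⋯ ⊗ f ⊗ M = 0` for some number of factors. -/
def killedIdeal (f : X ⟶ F) : ObjectProperty (ModCat K) := fun M =>
  finitelyPresented K M ∧ TensorKilled f (𝟙 M)

theorem killedIdeal_isSerreTensorIdeal (hF : IsTensorFlat F) (f : X ⟶ F) :
    IsSerreTensorIdeal (killedIdeal f) where
  le_finitelyPresented _ h := h.1
  zero := by
    have : Epi ((yonedaMod K).map (𝟙 (𝟙_ K))) := inferInstance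
    have hZ : IsZero (coker (𝟙 (𝟙_ K))) := isZero_cokernel_of_epi _
    exact ⟨_, hZ, finitelyPresented_coker _, .of_eq_zero (hZ.eq_of_src _ _)⟩
  shortExact S hS h₁ h₂ h₃ := by
    have := hS.mono_f
    have := hS.epi_g
    constructor
    · rintro ⟨-, w⟩
      refine ⟨⟨h₁, .of_comp_mono hF S.f ?_⟩, ⟨h₃, .of_epi_comp (e := S.g) ?_⟩⟩
      · simpa using w.comp S.f (𝟙 _)
      · simpa using w.comp (𝟙 _) S.g
    · rintro ⟨⟨-, w₁⟩, ⟨-, w₃⟩⟩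
      exact ⟨h₂, .of_exact hF hS.exact w₁ (by simpa using w₃.comp S.g (𝟙 _))⟩
  tensor M N hM hN := ⟨finitelyPresented_tensorObj hM hN.1, by
    rw [← tensorHom_id]
    exact hN.2.tensor_left M⟩

end ideal

/-! ### Existence of homological primes -/

section primes

variable {K : Type u} [Category.{v} K] [EssentiallySmall.{v} K] [HasZeroObject K] [HasShift K ℤ]
  [Preadditive K] [∀ n : ℤ, (shiftFunctor K n).Additive] [Pretriangulated K]
  [MonoidalCategory K] [MonoidalPreadditive K]

/-- The union of a nonempty chain of Serre `⊗`-ideals is a Serre `⊗`-ideal. -/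
theorem isSerreTensorIdeal_of_isChain {c : Set (ObjectProperty (ModCat K))}
    (hc : IsChain (· ≤ ·) c) (hI : ∀ C ∈ c, IsSerreTensorIdeal C) (hne : c.Nonempty) :
    IsSerreTensorIdeal (fun M => ∃ C ∈ c, C M) where
  le_finitelyPresented := by
    rintro M ⟨C, hC, h⟩
    exact (hI C hC).le_finitelyPresented M h
  zero := by
    obtain ⟨C, hC⟩ := hne
    obtain ⟨Z, hZ, h⟩ := (hI C hC).zero
    exact ⟨Z, hZ, C, hC, h⟩
  shortExact S hS h₁ h₂ h₃ := by
    constructor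
    · rintro ⟨C, hC, h⟩
      have := ((hI C hC).shortExact S hS h₁ h₂ h₃).1 h
      exact ⟨⟨C, hC, this.1⟩, ⟨C, hC, this.2⟩⟩
    · rintro ⟨⟨C, hC, h⟩, ⟨D, hD, h'⟩⟩
      rcases hc.total hC hD with hCD | hDC
      · exact ⟨D, hD, ((hI D hD).shortExact S hS h₁ h₂ h₃).2 ⟨hCD _ h, h'⟩⟩
      · exact ⟨C, hC, ((hI C hC).shortExact S hS h₁ h₂ h₃).2 ⟨h, hDC _ h'⟩⟩
  tensor := by
    rintro M N hM ⟨C, hC, h⟩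
    exact ⟨C, hC, (hI C hC).tensor M N hM h⟩

theorem ne_finitelyPresented_iff {C : ObjectProperty (ModCat K)} (hC : IsSerreTensorIdeal C) :
    C ≠ finitelyPresented K ↔ ¬ C ((yonedaMod K).obj (𝟙_ K)) :=
  not_congr ⟨fun h => h ▸ finitelyPresented_yoneda _, hC.eq_finitelyPresented_of_unit⟩

/-- Every proper Serre `⊗`-ideal is contained in a homological prime. -/
theorem exists_isHomologicalPrime {C : ObjectProperty (ModCat K)} (hC : IsSerreTensorIdeal C)
    (h : ¬ C ((yonedaMod K).obj (𝟙_ K))) :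
    ∃ B, IsHomologicalPrime B ∧ C ≤ B := by
  obtain ⟨B, hCB, hB⟩ := zorn_le_nonempty₀
    {C : ObjectProperty (ModCat K) | IsSerreTensorIdeal C ∧ C ≠ finitelyPresented K}
    (fun c hc hchain D hD => by
      have hI := isSerreTensorIdeal_of_isChain hchain (fun C hC => (hc hC).1) ⟨D, hD⟩
      refine ⟨_, ⟨hI, (ne_finitelyPresented_iff hI).2 ?_⟩, fun E hE M hM => ⟨E, hE, hM⟩⟩
      rintro ⟨E, hE, h1⟩
      exact (ne_finitelyPresented_iff (hc hE).1).1 (hc hE).2 h1)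
    C ⟨hC, (ne_finitelyPresented_iff hC).2 h⟩
  exact ⟨B, hB, hCB⟩

end primes

/-! ### The nilpotence theorem -/

section nilpotence

variable {K : Type u} [Category.{v} K] [EssentiallySmall.{v} K] [HasZeroObject K] [HasShift K ℤ]
  [Preadditive K] [∀ n : ℤ, (shiftFunctor K n).Additive] [Pretriangulated K]
  [MonoidalCategory K] [MonoidalPreadditive K]

/-- If `f : x̂ ⟶ F` kills the image of `a : y ⟶ x`, and `k : w ⟶ 1` is such that `x ⊗ k` factors
through `a`, then `f ⊗ J = 0`, where `J ⊆ 1̂` is the image of `k`: since `F` is flat, `F ⊗ J` embeds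
in `F`. -/
theorem tensorHom_kernel_eq_zero {x y w : K} {F : ModCat K} (hF : IsTensorFlat F)
    {f : (yonedaMod K).obj x ⟶ F} {a : y ⟶ x} (hf : (yonedaMod K).map a ≫ f = 0) {k : w ⟶ 𝟙_ K}
    {s : x ⊗ w ⟶ y} (hs : x ◁ k ≫ (ρ_ x).hom = s ≫ a) :
    tensorHom f (𝟙 (kernel (cokernel.π ((yonedaMod K).map k)))) = 0 := by
  let i := kernel.ι (cokernel.π ((yonedaMod K).map k))
  let q := kernel.lift (cokernel.π ((yonedaMod K).map k)) ((yonedaMod K).map k)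
    (cokernel.condition _)
  have hqi : q ≫ i = (yonedaMod K).map k := kernel.lift_ι _ _ _
  have : Epi q := Abelian.instEpiFactorThruImage _
  have : PreservesFiniteLimits (tensorLeftFunctor F) := hF.1
  have : Mono (tensorHom (𝟙 F) i) := inferInstanceAs (Mono ((tensorLeftFunctor F).map i))
  have hx : tensorHom (𝟙 ((yonedaMod K).obj x)) ((yonedaMod K).map k) ≫ (rightUnitIso _).hom =
      (yonedaTensorIso x w).hom ≫ (yonedaMod K).map (x ◁ k ≫ (ρ_ x).hom) := by
    rw [rightUnitIso_yoneda, ← Category.assoc, yonedaTensorIso_naturality_right, Category.assoc,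
      Functor.map_comp]
  -- it suffices to see that `x̂ ⊗ ŵ ⟶ x̂ ⊗ J ⟶ F ⊗ J ⟶ F ⊗ 1̂ ≅ F` vanishes
  rw [← cancel_mono (tensorHom (𝟙 F) i), ← cancel_epi (tensorHom (𝟙 ((yonedaMod K).obj x)) q),
    ← cancel_mono (rightUnitIso F).hom, zero_comp, comp_zero, zero_comp, ← tensorHom_comp,
    ← tensorHom_comp, Category.id_comp, Category.id_comp, Category.comp_id, hqi]
  calc tensorHom f ((yonedaMod K).map k) ≫ (rightUnitIso F).hom
      = tensorHom (𝟙 _) ((yonedaMod K).map k) ≫ tensorHom f (𝟙 _) ≫ (rightUnitIso F).hom := by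
        rw [← Category.assoc, ← tensorHom_comp, Category.id_comp, Category.comp_id]
    _ = 0 := by
        rw [rightUnitIso_naturality, reassoc_of% hx, hs, Functor.map_comp, Category.assoc, hf,
          comp_zero, comp_zero]

variable [RigidCategory K]

/-- If `a : y ⟶ x` has cokernel in `B`, there is `k : w ⟶ 1` with cokernel in `B` such that `x ⊗ k`
factors through `a`. This is where duals are used: `k` is a weak kernel of the composite
`1̂ ⟶ (ᘁx ⊗ x)^ ⟶ (ᘁx)^ ⊗ coker a`, where `ᘁx` is the dual of `x`. -/
theorem IsSerreTensorIdeal.exists_unit_coker {B : ObjectProperty (ModCat K)}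
    (hB : IsSerreTensorIdeal B) {x y : K} {a : y ⟶ x} (ha : B (coker a)) :
    ∃ (w : K) (k : w ⟶ 𝟙_ K) (s : x ⊗ w ⟶ y), B (coker k) ∧ x ◁ k ≫ (ρ_ x).hom = s ≫ a := by
  let D := (yonedaMod K).obj (ᘁx)
  let π := cokernel.π ((yonedaMod K).map a)
  obtain ⟨w, k, hk, hk'⟩ := hB.exists_coker (hB.tensor D _ (finitelyPresented_yoneda _) ha)
    ((yonedaMod K).map (η_ (ᘁx) x) ≫ (yonedaTensorIso (ᘁx) x).inv ≫ tensorHom (𝟙 D) π)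
  -- right exactness of the tensor product gives the factorization of `w ⟶ 1 ⟶ ᘁx ⊗ x`
  -- through `ᘁx ⊗ a`
  have hk₀ : ((yonedaMod K).map (k ≫ η_ (ᘁx) x) ≫ (yonedaTensorIso (ᘁx) x).inv) ≫
      tensorHom (𝟙 D) π = 0 := by
    simpa using hk
  obtain ⟨(l : (yonedaMod K).obj w ⟶ tensorObj D ((yonedaMod K).obj y)), hl⟩ :=
    yoneda_lift_exact (exact_tensorLeft D (cokerSequence_exact a)) _ hk₀
  obtain ⟨t, ht⟩ := yoneda_map_surjective (l ≫ (yonedaTensorIso (ᘁx) y).hom)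
  have ht' : k ≫ η_ (ᘁx) x = t ≫ (ᘁx) ◁ a := by
    have e : (yonedaMod K).map (k ≫ η_ (ᘁx) x) = (yonedaMod K).map (t ≫ (ᘁx) ◁ a) := by
      rw [Functor.map_comp _ t, ht, Category.assoc, ← yonedaTensorIso_naturality_right,
        ← Category.assoc, ← Iso.comp_inv_eq]
      exact hl.symm
    refine ySec_injective ?_
    simpa using congrArg (fun h => secMap h w (ySec (𝟙 w))) e
  refine ⟨w, k, x ◁ t ≫ (α_ _ _ _).inv ≫ ε_ (ᘁx) x ▷ y ≫ (λ_ y).hom, hk', ?_⟩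
  calc x ◁ k ≫ (ρ_ x).hom = x ◁ k ≫ (x ◁ η_ (ᘁx) x ≫ (α_ _ _ _).inv ≫ ε_ (ᘁx) x ▷ x) ≫
        (λ_ x).hom := by
        rw [ExactPairing.coevaluation_evaluation]; simp
    _ = x ◁ (k ≫ η_ (ᘁx) x) ≫ (α_ _ _ _).inv ≫ ε_ (ᘁx) x ▷ x ≫ (λ_ x).hom := by simp
    _ = _ := by
      rw [ht']
      simp only [MonoidalCategory.whiskerLeft_comp, Category.assoc,
        associator_inv_naturality_right_assoc, whisker_exchange_assoc, leftUnitor_naturality]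

end nilpotence

end TTNilpotence

end

open TTNilpotence
theorem corollary4p2 {K : Type u} [Category.{v} K] [EssentiallySmall.{v} K]
    [HasZeroObject K] [HasShift K ℤ] [Preadditive K] [∀ n : ℤ, (shiftFunctor K n).Additive]
    [Pretriangulated K] [IsTriangulated K] [MonoidalCategory K] [SymmetricCategory K]
    [TensorTriangulated K] [RigidCategory K]
    (x : K) (F : ModCat K) (hF : IsTensorFlat F) (f : (yonedaMod K).obj x ⟶ F)
    (hf : ∀ B : ObjectProperty (ModCat K), IsHomologicalPrime B → (gabrielQuotient B).map f = 0) :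
    IsTensorNilpotent f := by
  have hI := killedIdeal_isSerreTensorIdeal hF f
  by_cases h : killedIdeal f ((yonedaMod K).obj (𝟙_ K))
  · exact h.2.isTensorNilpotent 0 (𝟙 _) (𝟙 _) ((Category.id_comp _).trans (Category.comp_id _))
  obtain ⟨B, hB, hle⟩ := exists_isHomologicalPrime hI h
  obtain ⟨hBI, hBne⟩ := hB.prop
  obtain ⟨y, a, ha, hfa⟩ := exists_coker_of_gabrielQuotient_map_eq_zero hBI f (hf B hB)
  obtain ⟨w, k, s, hk, hs⟩ := hBI.exists_unit_coker ha
  -- the unit is an extension of `coker k` by the image `J` of `k`, and `J` is killed by `f`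
  let π := cokernel.π ((yonedaMod K).map k)
  have hS : (ShortComplex.mk (kernel.ι π) π (kernel.condition π)).ShortExact :=
    { exact := ShortComplex.exact_kernel π }
  have hJ : killedIdeal f (kernel π) :=
    ⟨finitelyPresented_of_shortExact hS (finitelyPresented_yoneda _) (finitelyPresented_coker k),
      .of_tensor (.of_eq_zero (tensorHom_kernel_eq_zero hF hfa hs))⟩
  exact ((ne_finitelyPresented_iff hBI).1 hBne
    (hBI.of_shortExact hS (finitelyPresented_yoneda _) (hle _ hJ) hk)).elim
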